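/- Setting. Let $\mu$ be a noise measure on $\mathbb R^2$: a compactly supported Borel probability measure with mean zero that is preserved by every orthogonal transformation fixing the first basis vector $\mathbf e_1$. Let $C_{ij}=\int x_ix_j\,d\mu(x)$, assume $C_{22}>0$, and put $$p=\frac{C_{11}+C_{22}+1}{C_{22}}\in(1,\infty).$$ For $v\in\mathbb R^2$ let $\mu_v$ be the image of $\mu$ under $|v|$ times an orthogonal transformation, chosen so that the product maps $\mathbf e_1$ to $v$. Let $\alpha=1+\inf\{R>0:\mu(B_R(0))=1\}$. For $\eta\in(0,2\pi)$ let $W_\eta=\{(r\cos\theta,r\sin\theta):r>0,\ -\eta/2<\theta<\eta/2\}$. For $\varepsilon>0$, the tug-of-war in $W_\eta$ with noise $\mu$ starts at $x_0\in W_\eta$. At step $k$ a fair coin is tossed. If $\operatorname{dist}(x_{k-1},\partial W_\eta)>\alpha\varepsilon$, the winner of the toss chooses $v_k$ with $|v_k|\le\varepsilon$ and the position moves to $x_k=x_{k-1}+v_k+z_k$, where $z_k$ is sampled from $\mu_{v_k}$. If $\operatorname{dist}(x_{k-1},\partial W_\eta)\le\alpha\varepsilon$, the winner chooses $x_k\in\partial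 W_\eta$ with $|x_k-x_{k-1}|\le\alpha\varepsilon$ and the game ends; the time to end the game is then $\tau=k$ (and $\tau=\infty$ if the game never ends). A strategy gives, for each step size $\varepsilon$ and each $k$, the player's choice at step $k$ as a Borel function of the history $(x_0,v_1,x_1,\dots,v_{k-1},x_{k-1})$. Strategies $S_I,S_{II}$ of players I and II and the starting point $x_0$ determine a probability law on the infinite histories, with expectation $E_{x_0}$. Theorem 1.1. If $$0<\eta<\pi\left[1-\frac12\sqrt{\frac{2(p-1)}{p}}\,\right],$$ then there are $\varepsilon_0>0$ and a strategy for player II in the tug-of-war with noise in $W_\eta$ such that $$\sup_{S_I}\ \sup_{0<\varepsilon<\varepsilon_0}\varepsilon^2E_{x_0}[\tau]<\infty\qquad\text{for every }x_0\in W_\eta,$$ where the first supremum is taken over all strategies $S_I$ of player I. -/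

import Mathlib

open MeasureTheory ProbabilityTheory
open scoped ENNReal

namespace TugOfWar

/-- The Euclidean plane. -/
abbrev Plane : Type := EuclideanSpace ℝ (Fin 2)

/-- The open wedge of angle `η` with vertex at the origin, symmetric about the first axis. -/
def wedge (η : ℝ) : Set Plane :=
  {x | ∃ r : ℝ, 0 < r ∧ ∃ θ : ℝ, -(η / 2) < θ ∧ θ < η / 2 ∧
    x = !₂[r * Real.cos θ, r * Real.sin θ]}

/-- The first standard basis vector. -/
noncomputable def e₁ : Plane := !₂[1, 0]

/-- A noise measure: compactly supported, of mean zero, and preserved by the orthogonal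
transformations that fix the first basis vector. (It is also a probability measure, which is an
instance argument wherever it is needed.) -/
structure IsNoise (μ : Measure Plane) : Prop where
  compact_support : ∃ K : Set Plane, IsCompact K ∧ μ Kᶜ = 0
  mean_zero : ∫ x, x ∂μ = 0
  invariant : ∀ L : Plane ≃ₗᵢ[ℝ] Plane, L e₁ = e₁ → μ.map L = μ

/-- The entries of the covariance matrix of the noise (coordinates are numbered `0`, `1`). -/
noncomputable def cov (μ : Measure Plane) (i j : Fin 2) : ℝ := ∫ x, x i * x j ∂μ

/-- The exponent `p = (C₁₁ + C₂₂ + 1) / C₂₂` of the noise. It is meaningful if `C₂₂ > 0`. -/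
noncomputable def exponent (μ : Measure Plane) : ℝ :=
  (cov μ 0 0 + cov μ 1 1 + 1) / cov μ 1 1

/-- The number `α = 1 + inf {R > 0 : μ (B_R(0)) = 1}`. -/
noncomputable def reach (μ : Measure Plane) : ℝ :=
  1 + sInf {R : ℝ | 0 < R ∧ μ (Metric.ball 0 R) = 1}

/-- The map `‖v‖` times the rotation that takes `e₁` to the direction of `v`; explicitly
`x ↦ x₁ v + x₂ v^⊥`, where `v^⊥` is `v` turned by a right angle. It sends `e₁` to `v`. -/
noncomputable def noiseMap (v x : Plane) : Plane :=
  !₂[x 0 * v 0 - x 1 * v 1, x 0 * v 1 + x 1 * v 0]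

/-- The noise measure `μ_v` that accompanies the move `v`. (Any other choice of `‖v‖` times an
orthogonal transformation taking `e₁` to `v` gives the same measure when `μ` is a noise.) -/
noncomputable def noiseAt (μ : Measure Plane) (v : Plane) : Measure Plane := μ.map (noiseMap v)

/-- Histories `(x₀, v₁, x₁, …, v_k, x_k)` up to step `k`. The `i`-th entry is the pair
`(v_i, x_i)`, with the dummy value `v₀ = 0`. -/
abbrev History (k : ℕ) : Type := Finset.Iic k → Plane × Plane

/-- The complete history space. -/
abbrev FullHistory : Type := ℕ → Plane × Plane

/-- The current position `x_k` of a history up to step `k`. -/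
def History.pos {k : ℕ} (h : History k) : Plane := (h ⟨k, Finset.mem_Iic.2 le_rfl⟩).2

/-- A strategy for the game in `D` with noise `μ` and step size `ε`. As a Borel function of the
history up to step `k`, it gives the vector `move k` of length at most `ε` that the player adds if
he wins the toss at step `k + 1` while the position is farther than `α ε` from the boundary, and
the boundary point `exit k` at distance at most `α ε` to which he goes if he wins the toss
at step `k + 1` while the position is within `α ε` of the boundary. -/
structure Strategy (μ : Measure Plane) (D : Set Plane) (ε : ℝ) where
  move : (k : ℕ) → History k → Plane
  measurable_move : ∀ k, Measurable (move k)
  norm_move_le : ∀ k h, ‖move k h‖ ≤ ε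
  exit : (k : ℕ) → History k → Plane
  measurable_exit : ∀ k, Measurable (exit k)
  exit_mem : ∀ k (h : History k), h.pos ∈ D →
    Metric.infDist h.pos (frontier D) ≤ reach μ * ε →
      exit k h ∈ frontier D ∧ dist (exit k h) h.pos ≤ reach μ * ε

section Law

variable (μ : Measure Plane) (D : Set Plane) (ε : ℝ)

open Classical in
/-- The law of the next entry `(v_{k+1}, x_{k+1})`, given the history `h` up to step `k` and given
that the player with strategy `S` wins the toss. If the game has ended, the position stays
where it is; a move that ends the game is recorded as `v_{k+1} = 0`. -/
noncomputable def winLaw (S : Strategy μ D ε) (k : ℕ) (h : History k) : Measure (Plane × Plane) :=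
  if h.pos ∈ frontier D then Measure.dirac (0, h.pos)
  else if reach μ * ε < Metric.infDist h.pos (frontier D) then
    (noiseAt μ (S.move k h)).map (fun z => (S.move k h, h.pos + S.move k h + z))
  else Measure.dirac (0, S.exit k h)

theorem measurable_pos (k : ℕ) : Measurable (History.pos : History k → Plane) :=
  measurable_snd.comp (measurable_pi_apply _)

theorem measurable_noiseMap : Measurable (fun q : Plane × Plane => noiseMap q.1 q.2) := by
  unfold noiseMap
  fun_prop

theorem measurable_noiseMap_right (v : Plane) : Measurable (noiseMap v) :=
  measurable_noiseMap.comp (measurable_const.prodMk measurable_id)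

variable [IsProbabilityMeasure μ]

theorem measurable_winLaw (S : Strategy μ D ε) (k : ℕ) : Measurable (winLaw μ D ε S k) := by
  have hpos := measurable_pos k
  have hmove := S.measurable_move k
  unfold winLaw
  refine Measurable.ite (hpos isClosed_frontier.measurableSet)
    (Measure.measurable_dirac.comp (measurable_const.prodMk hpos)) ?_
  refine Measurable.ite (measurableSet_lt measurable_const
    ((Metric.continuous_infDist_pt _).measurable.comp hpos)) ?_
    (Measure.measurable_dirac.comp (measurable_const.prodMk (S.measurable_exit k)))
  have hmeas : Measurable (fun q : History k × Plane =>
      (S.move k q.1, q.1.pos + S.move k q.1 + noiseMap (S.move k q.1) q.2)) := by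
    have h1 : Measurable (fun q : History k × Plane => S.move k q.1) := hmove.comp measurable_fst
    have h2 : Measurable (fun q : History k × Plane => q.1.pos) := hpos.comp measurable_fst
    exact h1.prodMk ((h2.add h1).add (measurable_noiseMap.comp (h1.prodMk measurable_snd)))
  refine Measure.measurable_of_measurable_coe _ fun s hs => ?_
  have key : ∀ h : History k,
      ((noiseAt μ (S.move k h)).map (fun z => (S.move k h, h.pos + S.move k h + z))) s =
        μ (Prod.mk h ⁻¹' ((fun q : History k × Plane =>
      (S.move k q.1, q.1.pos + S.move k q.1 + noiseMap (S.move k q.1) q.2)) ⁻¹' s)) := by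
    intro h
    rw [noiseAt, Measure.map_map (by fun_prop) (measurable_noiseMap_right _),
      Measure.map_apply (Measurable.comp (by fun_prop) (measurable_noiseMap_right _)) hs]
    rfl
  simp_rw [key]
  exact measurable_measure_prodMk_left (hmeas hs)

instance isProbabilityMeasure_winLaw (S : Strategy μ D ε) (k : ℕ) (h : History k) :
    IsProbabilityMeasure (winLaw μ D ε S k h) := by
  unfold winLaw noiseAt
  split_ifs
  · infer_instance
  · have := Measure.isProbabilityMeasure_map (μ := μ)
      (measurable_noiseMap_right (S.move k h)).aemeasurable
    exact Measure.isProbabilityMeasure_map (Measurable.aemeasurable (by fun_prop))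
  · infer_instance

/-- The transition kernel of the game: a fair coin decides who wins step `k + 1`. -/
noncomputable def gameKernel (S₁ S₂ : Strategy μ D ε) (k : ℕ) :
    Kernel (History k) (Plane × Plane) where
  toFun h := (2⁻¹ : ℝ≥0∞) • winLaw μ D ε S₁ k h + (2⁻¹ : ℝ≥0∞) • winLaw μ D ε S₂ k h
  measurable' := by
    have h1 := measurable_winLaw μ D ε S₁ k
    have h2 := measurable_winLaw μ D ε S₂ k
    refine Measure.measurable_of_measurable_coe _ fun s hs => ?_
    simp only [Measure.add_apply, Measure.smul_apply, smul_eq_mul]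
    exact (((Measure.measurable_coe hs).comp h1).const_mul _).add
      (((Measure.measurable_coe hs).comp h2).const_mul _)

instance isMarkovKernel_gameKernel (S₁ S₂ : Strategy μ D ε) (k : ℕ) :
    IsMarkovKernel (gameKernel μ D ε S₁ S₂ k) := by
  refine ⟨fun h => ⟨?_⟩⟩
  change ((2⁻¹ : ℝ≥0∞) • winLaw μ D ε S₁ k h + (2⁻¹ : ℝ≥0∞) • winLaw μ D ε S₂ k h) Set.univ = 1
  simp [ENNReal.inv_two_add_inv_two]

/-- The law on the complete history space determined by the strategies `S₁` and `S₂` of players I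
and II and the starting point `x₀`. -/
noncomputable def gameLaw (S₁ S₂ : Strategy μ D ε) (x₀ : Plane) : Measure FullHistory :=
  Kernel.traj (X := fun _ => Plane × Plane) (gameKernel μ D ε S₁ S₂) 0 (fun _ => (0, x₀))

/-- The time to end the game: the first `k` with `x_k` on the boundary (`∞` if there is none). -/
noncomputable def endTime (h : FullHistory) : ℝ≥0∞ :=
  ⨅ (k : ℕ) (_ : (h k).2 ∈ frontier D), (k : ℝ≥0∞)

/-- The expected time to end the game. -/
noncomputable def expectedEndTime (S₁ S₂ : Strategy μ D ε) (x₀ : Plane) : ℝ≥0∞ :=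
  ∫⁻ h, endTime D h ∂(gameLaw μ D ε S₁ S₂ x₀)

end Law

end TugOfWar

/-!
The proof exhibits a supersolution of the limiting equation that is homogeneous of degree two.
Write `A = 1 + C₁₁` and `B = C₂₂`, so that `p - 1 = A / B`. In the mean, a move `v` together with
its noise changes a smooth function `u` by `∇u · v + (A D²u(v, v) + B D²u(v^⊥, v^⊥)) / 2`. If player
II always moves by `ε` against `∇u`, the best answer of player I is, up to an error `O(ε³)`, to move
by `ε` along `∇u`, and the first-order terms cancel. So `u(x_k)` decreases in the mean by a multiple
of `ε²` as soon as `A u_nn + B u_tt < 0`, where `n` is the direction of `∇u` and `t ⊥ n`.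

The operator is linear in the hodograph plane. If `u` is the Legendre transform of `ρ² cos (κ ω)`,
with `(ρ, ω)` the polar coordinates of the gradient, then `A u_nn + B u_tt` is a positive multiple of
`A (κ² / 2 - 1) - B`, and `u` is defined and positive in the wedge of half angle
`π / 2 * (1 - 1 / κ)`. The hypothesis on `η` says exactly that the wedge is smaller than the one
that belongs to the critical `κ = √(2 (A + B) / A)`; hence there is a slightly smaller `κ > √2`
whose wedge still contains `W_η`, and for it the inequality is strict
(`exists_hodograph_frequency`).

With `a = κ ω`, the Legendre transform is a minimum over the direction of the gradient,
`u(x) = min_a (x · e(a / κ))² / (4 cos a)` with `e(ω) = (cos ω, sin ω)`. Inserting any value of `a`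
gives an upper bound. Therefore no differentiability of `u` is needed: an affine choice of `a` near
the minimizer gives the second-order upper expansion (`exists_quadratic_bound`,
`exists_expansion`), uniformly by homogeneity, with an error `|y|³ / |x|`. The minimizer is found by
inverting `polarAngle`, which is antitone because `κ² > 2` (`dualPot_le`).

The error is harmless only if `|x|` is at least a large multiple of `ε`. As the wedge is convex, it
may be translated by `M ε` into itself, away from the vertex; so `u(x + M ε e₁)` serves as the
Lyapunov function (`exists_supersolution`). A telescoping sum along the trajectory kernel
(`mul_expectedEndTime_le`) turns the drift into a bound on the expected length of the game.
-/

namespace TugOfWar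

/-! ### Uniform second-order expansions -/

section Expansions

open Filter Asymptotics

section Jets

/-- `Jet l N f f₀ f₁ f₂` says that, along the filter `l`, the function `f` has the expansion
`f₀ + f₁ + f₂ + O(N³)` in which `fᵢ = O(Nⁱ)`. The terms `fᵢ` are functions of all the parameters,
so that the expansion is uniform in them. -/
structure Jet {ι : Type*} (l : Filter ι) (N f f₀ f₁ f₂ : ι → ℝ) : Prop where
  zero : f₀ =O[l] fun _ => (1 : ℝ)
  one : f₁ =O[l] N
  two : f₂ =O[l] fun i => N i ^ 2
  rem : (fun i => f i - (f₀ i + f₁ i + f₂ i)) =O[l] fun i => N i ^ 3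

variable {ι : Type*} {l : Filter ι} {N f g f₀ f₁ f₂ g₀ g₁ g₂ : ι → ℝ}

theorem Jet.add (hf : Jet l N f f₀ f₁ f₂) (hg : Jet l N g g₀ g₁ g₂) :
    Jet l N (fun i => f i + g i) (fun i => f₀ i + g₀ i) (fun i => f₁ i + g₁ i)
      (fun i => f₂ i + g₂ i) := by
  refine ⟨hf.zero.add hg.zero, hf.one.add hg.one, hf.two.add hg.two, ?_⟩
  refine (hf.rem.add hg.rem).congr_left fun i => ?_
  ring

theorem Jet.exact (h₀ : f₀ =O[l] fun _ => (1 : ℝ)) (h₁ : f₁ =O[l] N)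
    (h₂ : f₂ =O[l] fun i => N i ^ 2) :
    Jet l N (fun i => f₀ i + f₁ i + f₂ i) f₀ f₁ f₂ :=
  ⟨h₀, h₁, h₂, by simpa using isBigO_zero _ _⟩

theorem isBigO_pow_of_le (hN : N =O[l] fun _ => (1 : ℝ)) {m n : ℕ} (hmn : m ≤ n) :
    (fun i => N i ^ n) =O[l] fun i => N i ^ m := by
  obtain ⟨k, rfl⟩ := Nat.exists_eq_add_of_le hmn
  simpa [pow_add] using (isBigO_refl (fun i => N i ^ m) l).mul (hN.pow k)

theorem Jet.mul (hN : N =O[l] fun _ => (1 : ℝ)) (hf : Jet l N f f₀ f₁ f₂)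
    (hg : Jet l N g g₀ g₁ g₂) :
    Jet l N (fun i => f i * g i) (fun i => f₀ i * g₀ i) (fun i => f₀ i * g₁ i + f₁ i * g₀ i)
      (fun i => f₀ i * g₂ i + f₁ i * g₁ i + f₂ i * g₀ i) := by
  have hN2 : (fun i => N i ^ 2) =O[l] fun _ => (1 : ℝ) := by simpa using hN.pow 2
  have hN3 : (fun i => N i ^ 3) =O[l] fun _ => (1 : ℝ) := by simpa using hN.pow 3
  have hj : ∀ {u u₀ u₁ u₂ : ι → ℝ}, Jet l N u u₀ u₁ u₂ →
      (fun i => u₀ i + u₁ i + u₂ i) =O[l] fun _ => (1 : ℝ) := fun hu =>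
    (hu.zero.add (hu.one.trans hN)).add (hu.two.trans hN2)
  have hg' : g =O[l] fun _ => (1 : ℝ) := by
    refine ((hg.rem.trans hN3).add (hj hg)).congr_left fun i => ?_
    ring
  refine ⟨by simpa using hf.zero.mul hg.zero,
    (by simpa using hf.zero.mul hg.one : _ =O[l] N).add
      (by simpa using hf.one.mul hg.zero : _ =O[l] N), ?_, ?_⟩
  · refine ((by simpa using hf.zero.mul hg.two : _ =O[l] fun i => N i ^ 2).add ?_).add
      (by simpa using hf.two.mul hg.zero : _ =O[l] fun i => N i ^ 2)
    simpa [sq] using hf.one.mul hg.one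
  · have e1 : (fun i => (f i - (f₀ i + f₁ i + f₂ i)) * g i) =O[l] fun i => N i ^ 3 := by
      simpa using hf.rem.mul hg'
    have e2 : (fun i => (f₀ i + f₁ i + f₂ i) * (g i - (g₀ i + g₁ i + g₂ i))) =O[l]
        fun i => N i ^ 3 := by
      simpa using (hj hf).mul hg.rem
    have e3 : (fun i => f₁ i * g₂ i) =O[l] fun i => N i ^ 3 := by
      simpa [pow_succ'] using hf.one.mul hg.two
    have e4 : (fun i => f₂ i * g₁ i) =O[l] fun i => N i ^ 3 := by
      simpa [pow_succ] using hf.two.mul hg.one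
    have e5 : (fun i => f₂ i * g₂ i) =O[l] fun i => N i ^ 3 := by
      refine IsBigO.trans (g := fun i => N i ^ 4) ?_ (isBigO_pow_of_le hN (by norm_num))
      refine (hf.two.mul hg.two).congr_right fun i => ?_
      ring
    refine ((((e1.add e2).add e3).add e4).add e5).congr_left fun i => ?_
    ring

theorem jet_cos {δ : ι → ℝ} (hδ : δ =O[l] N) (h1 : ∀ᶠ i in l, |δ i| ≤ 1) :
    Jet l N (fun i => Real.cos (δ i)) (fun _ => 1) (fun _ => 0) (fun i => -(δ i ^ 2 / 2)) := by
  refine ⟨isBigO_refl _ _, isBigO_zero _ _, ?_, ?_⟩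
  · exact (((hδ.pow 2).const_mul_left (1 / 2)).neg_left).congr_left fun i => by ring
  · refine IsBigO.trans (IsBigO.of_bound 1 ?_) (hδ.pow 3)
    filter_upwards [h1] with i hi
    have hb := Real.cos_bound hi
    have h4 : |δ i| ^ 4 ≤ |δ i| ^ 3 := pow_le_pow_of_le_one (abs_nonneg _) hi (by norm_num)
    rw [Real.norm_eq_abs, Real.norm_eq_abs, abs_pow]
    have : Real.cos (δ i) - (1 + 0 + -(δ i ^ 2 / 2)) = Real.cos (δ i) - (1 - δ i ^ 2 / 2) := by
      ring
    rw [this]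
    nlinarith [pow_nonneg (abs_nonneg (δ i)) 3]

theorem jet_sin {δ : ι → ℝ} (hδ : δ =O[l] N) (h1 : ∀ᶠ i in l, |δ i| ≤ 1) :
    Jet l N (fun i => Real.sin (δ i)) (fun _ => 0) δ (fun _ => 0) := by
  refine ⟨isBigO_zero _ _, hδ, isBigO_zero _ _, ?_⟩
  refine IsBigO.trans (IsBigO.of_bound 1 ?_) (hδ.pow 3)
  filter_upwards [h1] with i hi
  have hb := Real.sin_bound hi
  have h4 : |δ i| ^ 5 ≤ |δ i| ^ 3 := pow_le_pow_of_le_one (abs_nonneg _) hi (by norm_num)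
  rw [Real.norm_eq_abs, Real.norm_eq_abs, abs_pow]
  have : Real.sin (δ i) - (0 + δ i + 0) =
      (Real.sin (δ i) - (δ i - δ i ^ 3 / 6)) - δ i ^ 3 / 6 := by ring
  rw [this]
  have h5 : |δ i ^ 3 / 6| = |δ i| ^ 3 / 6 := by rw [abs_div, abs_pow]; norm_num
  have := abs_sub (Real.sin (δ i) - (δ i - δ i ^ 3 / 6)) (δ i ^ 3 / 6)
  nlinarith [pow_nonneg (abs_nonneg (δ i)) 3]

end Jets

/-! ### The second-order bound in the hodograph variables -/

/-- The denominator of the second-order part of the potential, at the point with hodograph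
parameter `a`. -/
noncomputable def curv (κ a : ℝ) : ℝ :=
  (κ ^ 2 / 2 - 1) * Real.cos a + (κ * Real.sin a) ^ 2 / (4 * Real.cos a)

/-- The second-order part of the potential, in the frame of its gradient. -/
noncomputable def quadPart (κ a y₁ y₂ : ℝ) : ℝ :=
  ((κ ^ 2 / 2 - 1) * y₁ ^ 2 - κ * Real.sin a / Real.cos a * (y₁ * y₂) - y₂ ^ 2) / (4 * curv κ a)

/-- The value of the quadratic form in `d` at its minimizer. -/
theorem quadratic_min_eq {χ s m D d y₁ y₂ : ℝ} (hχ : χ ≠ 0) (hD : D ≠ 0)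
    (hDe : D = m * χ + s ^ 2 / (4 * χ)) (hd : d = -(s / (2 * χ) * y₁ + y₂) / (2 * D)) :
    (m * y₁ ^ 2 - s / χ * (y₁ * y₂) - y₂ ^ 2) / (4 * D) =
      (y₁ + s * d) ^ 2 / (4 * χ) + m * χ * d ^ 2 + y₂ * d := by
  have h1 : (y₁ + s * d) ^ 2 / (4 * χ) + m * χ * d ^ 2 + y₂ * d =
      y₁ ^ 2 / (4 * χ) + d * (s / (2 * χ) * y₁ + y₂) + D * d ^ 2 := by
    rw [hDe]; field_simp; ring
  have h2 : m = (D - s ^ 2 / (4 * χ)) / χ := by rw [hDe]; field_simp; ring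
  rw [h1, hd, h2]
  field_simp
  ring

theorem cos_le_cos_of_abs_le {a b : ℝ} (h : |a| ≤ b) (hb : b ≤ Real.pi) :
    Real.cos b ≤ Real.cos a := by
  rw [← Real.cos_abs a]
  exact Real.cos_le_cos_of_nonneg_of_le_pi (abs_nonneg a) hb h

theorem curv_lower {κ a a₂ : ℝ} (hκ : 2 < κ ^ 2) (ha₂ : a₂ < Real.pi / 2) (ha : |a| ≤ a₂) :
    (κ ^ 2 / 2 - 1) * Real.cos a₂ ≤ curv κ a := by
  have hc := cos_le_cos_of_abs_le ha (by linarith [Real.pi_pos])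
  have hc0 : 0 < Real.cos a₂ :=
    Real.cos_pos_of_mem_Ioo ⟨by linarith [abs_nonneg a, Real.pi_pos], ha₂⟩
  unfold curv
  have : 0 ≤ (κ * Real.sin a) ^ 2 / (4 * Real.cos a) := by
    have : 0 < Real.cos a := hc0.trans_le hc
    positivity
  nlinarith

/-- The second-order upper expansion at the points with unit gradient. The left side is the dual
potential of the displaced point at the parameter `a + κ δ`; no minimality is used. -/
theorem exists_quadratic_bound {κ a₂ : ℝ} (hκ : 2 < κ ^ 2) (hκ0 : 0 < κ) (h0 : 0 ≤ a₂)
    (ha₂ : a₂ < Real.pi / 2) :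
    ∃ K N₀ : ℝ, 0 ≤ K ∧ 0 < N₀ ∧ ∀ a y₁ y₂ N : ℝ, |a| ≤ a₂ → |y₁| ≤ N → |y₂| ≤ N → N ≤ N₀ →
      ∃ δ : ℝ, |a + κ * δ| < Real.pi / 2 ∧
        ((2 * Real.cos a + y₁) * Real.cos δ + (-(κ * Real.sin a) + y₂) * Real.sin δ) ^ 2 /
          (4 * Real.cos (a + κ * δ)) ≤
        Real.cos a + y₁ + quadPart κ a y₁ y₂ + K * N ^ 3 := by
  set c := Real.cos a₂ with hc
  have hc0 : 0 < c := Real.cos_pos_of_mem_Ioo ⟨by linarith [Real.pi_pos], ha₂⟩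
  have hm : 0 < κ ^ 2 / 2 - 1 := by linarith
  have hκ1 : 1 < κ := by nlinarith
  -- the displacement of the dual variable that minimizes the second-order expansion
  set d : ℝ × ℝ × ℝ × ℝ → ℝ := fun i =>
    -((κ * Real.sin i.1 / (2 * Real.cos i.1)) * i.2.1 + i.2.2.1) / (2 * curv κ i.1) with hd
  set Λ : ℝ := (κ / (2 * c) + 1) / (2 * ((κ ^ 2 / 2 - 1) * c)) with hΛ
  have hΛ0 : 0 < Λ := by positivity
  set r := (Real.pi / 2 - a₂) / 2 with hr
  have hr0 : 0 < r := by rw [hr]; linarith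
  set N₀ := min 1 (min (1 / (κ * Λ)) (r / (κ * Λ))) with hN₀
  have hN₀0 : 0 < N₀ := by positivity
  set S : Set (ℝ × ℝ × ℝ × ℝ) :=
    {i | |i.1| ≤ a₂ ∧ |i.2.1| ≤ i.2.2.2 ∧ |i.2.2.1| ≤ i.2.2.2 ∧ i.2.2.2 ≤ N₀} with hS
  set N : ℝ × ℝ × ℝ × ℝ → ℝ := fun i => i.2.2.2 with hN
  have hcos : ∀ i ∈ S, c ≤ Real.cos i.1 := fun i hi =>
    cos_le_cos_of_abs_le hi.1 (by linarith [Real.pi_pos])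
  have hcurv : ∀ i ∈ S, (κ ^ 2 / 2 - 1) * c ≤ curv κ i.1 := fun i hi => curv_lower hκ ha₂ hi.1
  have hmc : 0 < (κ ^ 2 / 2 - 1) * c := by positivity
  have hNn : ∀ i ∈ S, 0 ≤ N i := fun i hi => (abs_nonneg _).trans hi.2.1
  have hdle : ∀ i ∈ S, |d i| ≤ Λ * N i := by
    intro i hi
    have h1 := hcos i hi
    have h2 := hcurv i hi
    have hci : 0 < Real.cos i.1 := hc0.trans_le h1
    have hDi : 0 < curv κ i.1 := hmc.trans_le h2
    have hq : |κ * Real.sin i.1 / (2 * Real.cos i.1)| ≤ κ / (2 * c) := by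
      rw [abs_div, abs_mul, abs_of_pos hκ0, abs_of_pos (by positivity : 0 < 2 * Real.cos i.1)]
      have := Real.abs_sin_le_one i.1
      exact div_le_div₀ hκ0.le (by nlinarith) (by positivity) (by linarith)
    have hnum : |κ * Real.sin i.1 / (2 * Real.cos i.1) * i.2.1 + i.2.2.1| ≤
        (κ / (2 * c) + 1) * N i := by
      calc _ ≤ |κ * Real.sin i.1 / (2 * Real.cos i.1)| * |i.2.1| + |i.2.2.1| := by
            rw [← abs_mul]; exact abs_add_le _ _
        _ ≤ κ / (2 * c) * N i + N i := by
            gcongr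
            · exact hi.2.1
            · exact hi.2.2.1
        _ = _ := by ring
    rw [hd]
    simp only
    rw [abs_div, abs_neg, abs_of_pos (by positivity : 0 < 2 * curv κ i.1)]
    have := hNn i hi
    refine (div_le_div₀ (by positivity) hnum (by positivity)
      (mul_le_mul_of_nonneg_left h2 zero_le_two)).trans_eq ?_
    rw [hΛ, div_mul_eq_mul_div]
  have hκd : ∀ i ∈ S, |κ * d i| ≤ 1 ∧ |κ * d i| ≤ r := by
    intro i hi
    have h1 : |κ * d i| ≤ κ * Λ * N i := by
      rw [abs_mul, abs_of_pos hκ0, mul_assoc]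
      gcongr
      exact hdle i hi
    have h2 : N i ≤ 1 / (κ * Λ) :=
      hi.2.2.2.trans ((min_le_right _ _).trans (min_le_left _ _))
    have h3 : N i ≤ r / (κ * Λ) :=
      hi.2.2.2.trans ((min_le_right _ _).trans (min_le_right _ _))
    rw [le_div_iff₀ (by positivity)] at h2 h3
    exact ⟨by linarith, by linarith⟩
  have hd1 : ∀ i ∈ S, |d i| ≤ 1 := by
    intro i hi
    have := (hκd i hi).1
    rw [abs_mul, abs_of_pos hκ0] at this
    nlinarith [abs_nonneg (d i)]
  have bound : ∀ {u v : ℝ × ℝ × ℝ × ℝ → ℝ} (C : ℝ), (∀ i ∈ S, |u i| ≤ C * |v i|) →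
      u =O[𝓟 S] v := fun C h => isBigO_principal.2 ⟨C, h⟩
  have hNO : N =O[𝓟 S] fun _ => (1 : ℝ) := bound 1 fun i hi => by
    rw [abs_of_nonneg (hNn i hi)]
    simpa using hi.2.2.2.trans (min_le_left _ _)
  have hdO : d =O[𝓟 S] N := bound Λ fun i hi => by
    rw [abs_of_nonneg (hNn i hi)]; exact hdle i hi
  have hκdO : (fun i => κ * d i) =O[𝓟 S] N := hdO.const_mul_left κ
  have hχO : (fun i : ℝ × ℝ × ℝ × ℝ => Real.cos i.1) =O[𝓟 S] fun _ => (1 : ℝ) :=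
    bound 1 fun i _ => by simpa using Real.abs_cos_le_one i.1
  have hsO : (fun i : ℝ × ℝ × ℝ × ℝ => Real.sin i.1) =O[𝓟 S] fun _ => (1 : ℝ) :=
    bound 1 fun i _ => by simpa using Real.abs_sin_le_one i.1
  have hy1 : (fun i : ℝ × ℝ × ℝ × ℝ => i.2.1) =O[𝓟 S] N := bound 1 fun i hi => by
    rw [abs_of_nonneg (hNn i hi)]; simpa using hi.2.1
  have hy2 : (fun i : ℝ × ℝ × ℝ × ℝ => i.2.2.1) =O[𝓟 S] N := bound 1 fun i hi => by
    rw [abs_of_nonneg (hNn i hi)]; simpa using hi.2.2.1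
  have z1 : (fun _ => (0 : ℝ)) =O[𝓟 S] N := isBigO_zero _ _
  have z2 : (fun _ => (0 : ℝ)) =O[𝓟 S] fun i => N i ^ 2 := isBigO_zero _ _
  have hq : ∀ i ∈ S, quadPart κ i.1 i.2.1 i.2.2.1 =
      (i.2.1 + κ * Real.sin i.1 * d i) ^ 2 / (4 * Real.cos i.1) +
        (κ ^ 2 / 2 - 1) * Real.cos i.1 * d i ^ 2 + i.2.2.1 * d i := by
    intro i hi
    exact quadratic_min_eq (hc0.trans_le (hcos i hi)).ne' (hmc.trans_le (hcurv i hi)).ne' rfl rfl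
  have hinvχ : (fun i : ℝ × ℝ × ℝ × ℝ => (4 * Real.cos i.1)⁻¹) =O[𝓟 S] fun _ => (1 : ℝ) :=
    bound (4 * c)⁻¹ fun i hi => by
      have h1 := hcos i hi
      have hci : 0 < Real.cos i.1 := hc0.trans_le h1
      rw [abs_of_pos (by positivity), abs_one, mul_one]
      gcongr
  have hqO : (fun i : ℝ × ℝ × ℝ × ℝ => quadPart κ i.1 i.2.1 i.2.2.1) =O[𝓟 S]
      fun i => N i ^ 2 := by
    have t1 : (fun i => i.2.1 + κ * Real.sin i.1 * d i) =O[𝓟 S] N :=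
      hy1.add (by simpa using (hsO.const_mul_left κ).mul hdO)
    have t2 := (t1.pow 2).mul hinvχ
    have t3 := (hχO.const_mul_left (κ ^ 2 / 2 - 1)).mul (hdO.pow 2)
    have t4 := hy2.mul hdO
    refine IsBigO.congr' (((t2.congr_right fun i => mul_one _).add
      (t3.congr_right fun i => one_mul _)).add
      (t4.congr_right fun i => (sq (N i)).symm)) ?_ (EventuallyEq.refl _ _)
    filter_upwards [mem_principal_self S] with i hi
    rw [hq i hi]
    ring
  -- the numerator is `A ^ 2`, the denominator `4 B`, and `G` is the claimed expansion; the three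
  -- terms of degree at most two of `A ^ 2 - 4 B G` cancel
  have jc : Jet (𝓟 S) N (fun i => Real.cos (d i)) (fun _ => 1) (fun _ => 0)
      (fun i => -(d i ^ 2 / 2)) := jet_cos hdO (eventually_principal.2 hd1)
  have js : Jet (𝓟 S) N (fun i => Real.sin (d i)) (fun _ => 0) d (fun _ => 0) :=
    jet_sin hdO (eventually_principal.2 hd1)
  have jc' := jet_cos hκdO (eventually_principal.2 fun i hi => (hκd i hi).1)
  have js' := jet_sin hκdO (eventually_principal.2 fun i hi => (hκd i hi).1)
  have jA := (Jet.mul hNO (Jet.exact (hχO.const_mul_left 2) hy1 z2) jc).add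
    (Jet.mul hNO (Jet.exact (hsO.const_mul_left (-κ)) hy2 z2) js)
  have jB := (Jet.mul hNO (Jet.exact hχO z1 z2) jc').add
    (Jet.mul hNO (Jet.exact hsO.neg_left z1 z2) js')
  have jG := Jet.exact hχO hy1 hqO
  have h4 : (fun _ : ℝ × ℝ × ℝ × ℝ => (-4 : ℝ)) =O[𝓟 S] fun _ => (1 : ℝ) :=
    isBigO_const_const _ one_ne_zero _
  have jR := (Jet.mul hNO jA jA).add (Jet.mul hNO (Jet.exact h4 z1 z2) (Jet.mul hNO jB jG))
  have hR : (fun i : ℝ × ℝ × ℝ × ℝ => ((2 * Real.cos i.1 + i.2.1) * Real.cos (d i) +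
      (-(κ * Real.sin i.1) + i.2.2.1) * Real.sin (d i)) ^ 2 - 4 * Real.cos (i.1 + κ * d i) *
      (Real.cos i.1 + i.2.1 + quadPart κ i.1 i.2.1 i.2.2.1)) =O[𝓟 S] fun i => N i ^ 3 := by
    refine jR.rem.congr' ?_ (EventuallyEq.refl _ _)
    filter_upwards [mem_principal_self S] with i hi
    have hci : Real.cos i.1 ≠ 0 := (hc0.trans_le (hcos i hi)).ne'
    have hq' : 4 * Real.cos i.1 * quadPart κ i.1 i.2.1 i.2.2.1 =
      (i.2.1 + κ * Real.sin i.1 * d i) ^ 2 +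
        4 * (κ ^ 2 / 2 - 1) * Real.cos i.1 ^ 2 * d i ^ 2 + 4 * Real.cos i.1 * i.2.2.1 * d i := by
      rw [hq i hi]; field_simp
    rw [Real.cos_add]
    linear_combination hq'
  obtain ⟨C, hC⟩ := isBigO_principal.1 hR
  set b := Real.cos (a₂ + r) with hb
  have hb0 : 0 < b := Real.cos_pos_of_mem_Ioo
    ⟨by linarith [Real.pi_pos], by rw [hr]; linarith⟩
  refine ⟨|C| / (4 * b), N₀, by positivity, hN₀0, fun a y₁ y₂ n ha h1 h2 hn => ?_⟩
  have hi : ((a, y₁, y₂, n) : ℝ × ℝ × ℝ × ℝ) ∈ S := ⟨ha, h1, h2, hn⟩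
  have hn0 : 0 ≤ n := hNn _ hi
  have hδ : |a + κ * d (a, y₁, y₂, n)| ≤ a₂ + r :=
    (abs_add_le _ _).trans (add_le_add ha (hκd _ hi).2)
  have hle : a₂ + r < Real.pi / 2 := by rw [hr]; linarith
  have hcosb : b ≤ Real.cos (a + κ * d (a, y₁, y₂, n)) :=
    cos_le_cos_of_abs_le hδ (by linarith [Real.pi_pos])
  refine ⟨d (a, y₁, y₂, n), hδ.trans_lt hle, ?_⟩
  have hRi := (le_abs_self _).trans (hC _ hi)
  simp only [hN, Real.norm_eq_abs, abs_of_nonneg (pow_nonneg hn0 3)] at hRi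
  set B := Real.cos (a + κ * d (a, y₁, y₂, n)) with hB
  have hB0 : 0 < B := hb0.trans_le hcosb
  rw [div_le_iff₀ (by positivity)]
  have h5 : C * n ^ 3 ≤ |C| / (4 * b) * n ^ 3 * (4 * B) := by
    calc C * n ^ 3 ≤ |C| * n ^ 3 := by gcongr; exact le_abs_self C
      _ = |C| / (4 * b) * n ^ 3 * (4 * b) := by field_simp
      _ ≤ _ := by gcongr
  linarith

end Expansions

/-! ### The minimizing hodograph parameter -/

section PolarAngle

open Filter

/-- The polar angle of the points whose hodograph parameter is `a`, that is, of the vector with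
coordinates `(2 cos a, -κ sin a)` in the standard frame turned by the angle `a / κ`. -/
noncomputable def polarAngle (κ a : ℝ) : ℝ := a / κ - Real.arctan (κ / 2 * Real.tan a)

theorem cos_pos_of_abs_lt {a : ℝ} (ha : |a| < Real.pi / 2) : 0 < Real.cos a :=
  Real.cos_pos_of_mem_Ioo (abs_lt.1 ha)

theorem polarAngle_neg (κ a : ℝ) : polarAngle κ (-a) = -polarAngle κ a := by
  simp [polarAngle, neg_div, Real.tan_neg, Real.arctan_neg]
  ring

theorem hasDerivAt_polarAngle (κ : ℝ) {a : ℝ} (ha : |a| < Real.pi / 2) :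
    HasDerivAt (polarAngle κ)
      (1 / κ - 1 / (1 + (κ / 2 * Real.tan a) ^ 2) * (κ / 2 * (1 / Real.cos a ^ 2))) a := by
  have h1 := Real.hasDerivAt_tan (cos_pos_of_abs_lt ha).ne'
  exact ((hasDerivAt_id a).div_const κ).sub ((h1.const_mul (κ / 2)).arctan)

theorem continuousOn_polarAngle (κ : ℝ) :
    ContinuousOn (polarAngle κ) (Set.Ioo (-(Real.pi / 2)) (Real.pi / 2)) := fun _ ha =>
  (hasDerivAt_polarAngle κ (abs_lt.2 ha)).continuousAt.continuousWithinAt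

theorem antitoneOn_polarAngle {κ : ℝ} (hκ : 2 < κ ^ 2) (hκ0 : 0 < κ) :
    AntitoneOn (polarAngle κ) (Set.Ioo (-(Real.pi / 2)) (Real.pi / 2)) := by
  refine antitoneOn_of_deriv_nonpos (convex_Ioo _ _) (continuousOn_polarAngle κ) ?_ ?_
  · rw [interior_Ioo]
    exact fun a ha =>
      (hasDerivAt_polarAngle κ (abs_lt.2 ha)).differentiableAt.differentiableWithinAt
  · rw [interior_Ioo]
    intro a ha
    have hc := cos_pos_of_abs_lt (abs_lt.2 ha)
    rw [(hasDerivAt_polarAngle κ (abs_lt.2 ha)).deriv, Real.tan_eq_sin_div_cos]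
    have hs := Real.sin_sq_add_cos_sq a
    have e : 1 / (1 + (κ / 2 * (Real.sin a / Real.cos a)) ^ 2) * (κ / 2 * (1 / Real.cos a ^ 2)) =
        (κ / 2) / (Real.cos a ^ 2 + κ ^ 2 / 4 * Real.sin a ^ 2) := by
      have : 0 < 4 * Real.cos a ^ 2 + κ ^ 2 * Real.sin a ^ 2 := by positivity
      field_simp
      ring
    rw [e, sub_nonpos, div_le_div_iff₀ hκ0 (by positivity)]
    nlinarith [sq_nonneg (Real.sin a), sq_nonneg (Real.cos a)]

/-- The polar angle exhausts the open wedge of half angle `π / 2 * (1 - 1 / κ)`: that half angle is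
its limit for `a → -π / 2`. -/
theorem exists_le_polarAngle_neg {κ h : ℝ} (hκ0 : 0 < κ)
    (hh : h < Real.pi / 2 * (1 - 1 / κ)) :
    ∃ b, 0 ≤ b ∧ b < Real.pi / 2 ∧ h ≤ polarAngle κ (-b) := by
  have ht : Tendsto (fun a => Real.arctan (κ / 2 * Real.tan a) - a / κ)
      (nhdsWithin (Real.pi / 2) (Set.Iio (Real.pi / 2)))
      (nhds (Real.pi / 2 - Real.pi / 2 / κ)) := by
    refine Tendsto.sub ?_ ?_
    · exact (Real.tendsto_arctan_atTop.mono_right nhdsWithin_le_nhds).comp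
        (Real.tendsto_tan_pi_div_two.const_mul_atTop (by positivity))
    · exact (((continuous_id.div_const κ).tendsto _).mono_left nhdsWithin_le_nhds)
  have hlt : h < Real.pi / 2 - Real.pi / 2 / κ := by
    have : Real.pi / 2 * (1 - 1 / κ) = Real.pi / 2 - Real.pi / 2 / κ := by ring
    linarith
  have hmem : Set.Ioo 0 (Real.pi / 2) ∈ nhdsWithin (Real.pi / 2) (Set.Iio (Real.pi / 2)) :=
    Ioo_mem_nhdsLT (by positivity)
  obtain ⟨b, hb1, hb2⟩ := ((ht.eventually (lt_mem_nhds hlt)).and hmem).exists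
  refine ⟨b, hb2.1.le, hb2.2, ?_⟩
  rw [polarAngle_neg]
  unfold polarAngle
  linarith

/-- The function `polarAngle κ` has a Borel right inverse on `[-h, h]`. As a supremum of superlevel
sets it is antitone, hence measurable, without an appeal to strict monotonicity. -/
theorem exists_measurable_polarAngle_inverse {κ h b : ℝ} (hb0 : 0 ≤ b) (hb : b < Real.pi / 2)
    (hh : h ≤ polarAngle κ (-b)) :
    ∃ sel : ℝ → ℝ, Measurable sel ∧ ∀ θ, |θ| ≤ h → |sel θ| ≤ b ∧ polarAngle κ (sel θ) = θ := by
  set s : ℝ → Set ℝ := fun θ => {a ∈ Set.Icc (-b) b | a = -b ∨ θ ≤ polarAngle κ a} with hs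
  have hsub : Set.Icc (-b) b ⊆ Set.Ioo (-(Real.pi / 2)) (Real.pi / 2) := fun a ha =>
    ⟨by linarith [ha.1], by linarith [ha.2]⟩
  have hcont : ContinuousOn (polarAngle κ) (Set.Icc (-b) b) :=
    (continuousOn_polarAngle κ).mono hsub
  have hbdd : ∀ θ, BddAbove (s θ) := fun θ => ⟨b, fun a ha => ha.1.2⟩
  have hne : ∀ θ, (s θ).Nonempty := fun θ => ⟨-b, ⟨le_rfl, by linarith⟩, Or.inl rfl⟩
  refine ⟨fun θ => sSup (s θ), ?_, fun θ hθ => ?_⟩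
  · refine Antitone.measurable fun θ θ' h' => ?_
    exact csSup_le_csSup (hbdd θ) (hne θ') fun a ha => ⟨ha.1, ha.2.imp_right h'.trans⟩
  have hθ1 := abs_le.1 hθ
  have hseq : s θ = Set.Icc (-b) b ∩ polarAngle κ ⁻¹' Set.Ici θ := by
    ext a
    refine ⟨fun ha => ⟨ha.1, ha.2.elim (fun h' => ?_) id⟩, fun ha => ⟨ha.1, Or.inr ha.2⟩⟩
    rw [h']; exact hθ1.2.trans hh
  have hclosed : IsClosed (s θ) := by
    rw [hseq]; exact hcont.preimage_isClosed_of_isClosed isClosed_Icc isClosed_Ici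
  have hmem : sSup (s θ) ∈ s θ := hclosed.csSup_mem (hne θ) (hbdd θ)
  refine ⟨abs_le.2 hmem.1, le_antisymm ?_ ?_⟩
  · -- to the right of the supremum the polar angle is below `θ`
    have hlast : polarAngle κ b ≤ θ := by
      have := polarAngle_neg κ b
      linarith
    change polarAngle κ (sSup (s θ)) ≤ θ
    rcases eq_or_lt_of_le hmem.1.2 with he | hlt
    · rw [he]; exact hlast
    · by_contra! hcon
      obtain ⟨a, ha, hae⟩ := intermediate_value_Icc' hmem.1.2
        (hcont.mono (Set.Icc_subset_Icc_left hmem.1.1)) (show θ ∈ _ from ⟨hlast, hcon.le⟩)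
      have hle : a ≤ sSup (s θ) := le_csSup (hbdd θ)
        ⟨⟨hmem.1.1.trans ha.1, ha.2⟩, Or.inr hae.ge⟩
      have : a = sSup (s θ) := le_antisymm hle ha.1
      rw [this] at hae
      linarith
  · exact (hseq.subset hmem).2

/-- The identity behind both the first-order condition for the minimization over the hodograph
parameter and its sign away from the minimum. -/
theorem sin_sub_polarAngle {κ a : ℝ} (θ : ℝ) (ha : |a| < Real.pi / 2) :
    Real.sin (θ - a / κ) * Real.cos a + κ / 2 * Real.cos (θ - a / κ) * Real.sin a =
      Real.cos a / Real.cos (Real.arctan (κ / 2 * Real.tan a)) *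
        Real.sin (θ - polarAngle κ a) := by
  have hc := cos_pos_of_abs_lt ha
  set ψ := Real.arctan (κ / 2 * Real.tan a) with hψ
  have hψc : 0 < Real.cos ψ := Real.cos_arctan_pos _
  have hψs : Real.sin ψ = κ / 2 * Real.tan a * Real.cos ψ := by
    rw [← Real.tan_mul_cos hψc.ne', hψ, Real.tan_arctan]
  have e : θ - polarAngle κ a = (θ - a / κ) + ψ := by rw [polarAngle, ← hψ]; ring
  rw [e, Real.sin_add, hψs, Real.tan_eq_sin_div_cos]
  field_simp

theorem hasDerivAt_dualPotential (κ θ : ℝ) {a : ℝ} (ha : |a| < Real.pi / 2) (hκ0 : 0 < κ) :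
    HasDerivAt (fun a => Real.cos (θ - a / κ) ^ 2 / Real.cos a)
      (2 / κ * Real.cos (θ - a / κ) / (Real.cos a * Real.cos (Real.arctan (κ / 2 * Real.tan a))) *
        Real.sin (θ - polarAngle κ a)) a := by
  have hc := cos_pos_of_abs_lt ha
  have h1 : HasDerivAt (fun a => θ - a / κ) (-(1 / κ)) a := by
    simpa using ((hasDerivAt_id a).div_const κ).const_sub θ
  convert! (h1.cos.pow 2).div (Real.hasDerivAt_cos a) hc.ne' using 1
  have := sin_sub_polarAngle (κ := κ) θ ha
  have hψc : 0 < Real.cos (Real.arctan (κ / 2 * Real.tan a)) := Real.cos_arctan_pos _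
  have e : Real.sin (θ - polarAngle κ a) = Real.cos (Real.arctan (κ / 2 * Real.tan a)) /
      Real.cos a * (Real.sin (θ - a / κ) * Real.cos a +
        κ / 2 * Real.cos (θ - a / κ) * Real.sin a) := by
    rw [this]; field_simp
  rw [e]
  simp
  field_simp

/-- The point of polar angle `polarAngle κ a` has `a` as the minimizer of its dual potential. -/
theorem dualPotential_le {κ θ a a' : ℝ} (hκ : 2 < κ ^ 2) (hκ0 : 0 < κ) (ha : |a| < Real.pi / 2)
    (ha' : |a'| < Real.pi / 2) (hθ : polarAngle κ a = θ)
    (hθ' : |θ| ≤ Real.pi / 2 * (1 - 1 / κ)) :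
    Real.cos (θ - a / κ) ^ 2 / Real.cos a ≤ Real.cos (θ - a' / κ) ^ 2 / Real.cos a' := by
  set I := Set.Ioo (-(Real.pi / 2)) (Real.pi / 2) with hI
  have haI : a ∈ I := abs_lt.1 ha
  have haI' : a' ∈ I := abs_lt.1 ha'
  have hanti := antitoneOn_polarAngle hκ hκ0
  have hd := fun x (hx : x ∈ I) => hasDerivAt_dualPotential κ θ (abs_lt.2 hx) hκ0
  have hφ : ∀ x ∈ I, |θ - x / κ| < Real.pi / 2 := by
    intro x hx
    have h1 : |x / κ| < Real.pi / 2 / κ := by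
      rw [abs_div, abs_of_pos hκ0]
      gcongr
      exact abs_lt.2 hx
    have h2 : Real.pi / 2 * (1 - 1 / κ) = Real.pi / 2 - Real.pi / 2 / κ := by ring
    have := abs_sub θ (x / κ)
    linarith
  have hpos : ∀ x ∈ I, 0 ≤ 2 / κ * Real.cos (θ - x / κ) /
      (Real.cos x * Real.cos (Real.arctan (κ / 2 * Real.tan x))) := by
    intro x hx
    have h1 := cos_pos_of_abs_lt (hφ x hx)
    have h2 := cos_pos_of_abs_lt (abs_lt.2 hx)
    have h3 := Real.cos_arctan_pos (κ / 2 * Real.tan x)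
    positivity
  have hrange : ∀ x ∈ I, |θ - polarAngle κ x| < Real.pi := by
    intro x hx
    have e : θ - polarAngle κ x = (θ - x / κ) + Real.arctan (κ / 2 * Real.tan x) := by
      rw [polarAngle]; ring
    have h1 := abs_lt.1 (hφ x hx)
    have h2 := Real.arctan_lt_pi_div_two (κ / 2 * Real.tan x)
    have h3 := Real.neg_pi_div_two_lt_arctan (κ / 2 * Real.tan x)
    rw [e, abs_lt]
    constructor <;> linarith
  rcases le_total a a' with hle | hle
  · have hsub : Set.Icc a a' ⊆ I := fun x hx => ⟨haI.1.trans_le hx.1, hx.2.trans_lt haI'.2⟩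
    have hmono : MonotoneOn (fun a => Real.cos (θ - a / κ) ^ 2 / Real.cos a) (Set.Icc a a') := by
      refine monotoneOn_of_deriv_nonneg (convex_Icc _ _)
        (fun x hx => (hd x (hsub hx)).continuousAt.continuousWithinAt)
        (fun x hx => (hd x (hsub (interior_subset hx))).differentiableAt.differentiableWithinAt)
        fun x hx => ?_
      have hx' := interior_subset hx
      rw [(hd x (hsub hx')).deriv]
      refine mul_nonneg (hpos x (hsub hx')) (Real.sin_nonneg_of_nonneg_of_le_pi ?_
        (abs_lt.1 (hrange x (hsub hx'))).2.le)
      linarith [hanti haI (hsub hx') hx'.1]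
    exact hmono ⟨le_rfl, hle⟩ ⟨hle, le_rfl⟩ hle
  · have hsub : Set.Icc a' a ⊆ I := fun x hx => ⟨haI'.1.trans_le hx.1, hx.2.trans_lt haI.2⟩
    have hmono : AntitoneOn (fun a => Real.cos (θ - a / κ) ^ 2 / Real.cos a) (Set.Icc a' a) := by
      refine antitoneOn_of_deriv_nonpos (convex_Icc _ _)
        (fun x hx => (hd x (hsub hx)).continuousAt.continuousWithinAt)
        (fun x hx => (hd x (hsub (interior_subset hx))).differentiableAt.differentiableWithinAt)
        fun x hx => ?_
      have hx' := interior_subset hx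
      rw [(hd x (hsub hx')).deriv]
      refine mul_nonpos_of_nonneg_of_nonpos (hpos x (hsub hx'))
        (Real.sin_nonpos_of_nonpos_of_neg_pi_le ?_ (abs_lt.1 (hrange x (hsub hx'))).1.le)
      linarith [hanti (hsub hx') haI hx'.2]
    exact hmono ⟨le_rfl, hle⟩ ⟨hle, le_rfl⟩ hle

end PolarAngle

/-! ### The supersolution and one round of the limiting game -/

/-- The degree-two homogeneous function that is dual to the hodograph parameter `a`. The
supersolution is its minimum over `a`. -/
noncomputable def dualPot (κ a u v : ℝ) : ℝ :=
  (u * Real.cos (a / κ) + v * Real.sin (a / κ)) ^ 2 / (4 * Real.cos a)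

theorem exists_polar {u : ℝ} (hu : 0 < u) (v : ℝ) :
    ∃ r, 0 < r ∧ u = r * Real.cos (Real.arctan (v / u)) ∧
      v = r * Real.sin (Real.arctan (v / u)) := by
  have hc := Real.cos_arctan_pos (v / u)
  refine ⟨u / Real.cos (Real.arctan (v / u)), by positivity, by field_simp, ?_⟩
  rw [← Real.tan_mul_cos hc.ne', Real.tan_arctan]
  field_simp

theorem dualPot_polar (κ a r θ : ℝ) :
    dualPot κ a (r * Real.cos θ) (r * Real.sin θ) =
      r ^ 2 / 4 * (Real.cos (θ - a / κ) ^ 2 / Real.cos a) := by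
  rw [dualPot, Real.cos_sub]
  have : r * Real.cos θ * Real.cos (a / κ) + r * Real.sin θ * Real.sin (a / κ) =
    r * (Real.cos θ * Real.cos (a / κ) + Real.sin θ * Real.sin (a / κ)) := by ring
  rw [this, mul_pow]
  ring

/-- The dual potential of a point is smallest at the parameter given by its polar angle. -/
theorem dualPot_le {κ u v a a' : ℝ} (hκ : 2 < κ ^ 2) (hκ0 : 0 < κ) (ha : |a| < Real.pi / 2)
    (ha' : |a'| < Real.pi / 2) (hu : 0 < u) (hθ : polarAngle κ a = Real.arctan (v / u))
    (hθ' : |Real.arctan (v / u)| ≤ Real.pi / 2 * (1 - 1 / κ)) :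
    dualPot κ a u v ≤ dualPot κ a' u v := by
  obtain ⟨r, hr, h1, h2⟩ := exists_polar hu v
  generalize Real.arctan (v / u) = θ at *
  subst h1 h2
  rw [dualPot_polar, dualPot_polar]
  exact mul_le_mul_of_nonneg_left (dualPotential_le hκ hκ0 ha ha' hθ hθ') (by positivity)

/-- In the frame turned by `a / κ`, a point with hodograph parameter `a` is a positive multiple
of `(2 cos a, -κ sin a)`. -/
theorem exists_frame {κ u v a : ℝ} (hκ0 : 0 < κ) (ha : |a| < Real.pi / 2) (hu : 0 < u)
    (hθ : polarAngle κ a = Real.arctan (v / u)) :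
    ∃ ρ, 0 < ρ ∧ u * Real.cos (a / κ) + v * Real.sin (a / κ) = ρ * (2 * Real.cos a) ∧
      -(u * Real.sin (a / κ)) + v * Real.cos (a / κ) = ρ * -(κ * Real.sin a) ∧
      u ≤ (2 + κ) * ρ := by
  obtain ⟨r, hr, h1, h2⟩ := exists_polar hu v
  generalize Real.arctan (v / u) = θ at *
  have hc := cos_pos_of_abs_lt ha
  have hφ : 0 < Real.cos (θ - a / κ) := by
    have : θ - a / κ = -Real.arctan (κ / 2 * Real.tan a) := by rw [← hθ, polarAngle]; ring
    rw [this, Real.cos_neg]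
    exact Real.cos_arctan_pos _
  have hs := sin_sub_polarAngle (κ := κ) θ ha
  rw [hθ, sub_self, Real.sin_zero, mul_zero] at hs
  set ρ := r * Real.cos (θ - a / κ) / (2 * Real.cos a) with hρ
  have hρ0 : 0 < ρ := by positivity
  have e1 : u * Real.cos (a / κ) + v * Real.sin (a / κ) = ρ * (2 * Real.cos a) := by
    rw [hρ, Real.cos_sub, h1, h2]; field_simp
  have e2 : -(u * Real.sin (a / κ)) + v * Real.cos (a / κ) = ρ * -(κ * Real.sin a) := by
    have : Real.sin (θ - a / κ) = -(κ / 2 * Real.cos (θ - a / κ) * Real.sin a) / Real.cos a := by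
      rw [eq_div_iff hc.ne']; linarith
    have h3 : -(u * Real.sin (a / κ)) + v * Real.cos (a / κ) = r * Real.sin (θ - a / κ) := by
      rw [Real.sin_sub, h1, h2]; ring
    rw [h3, this, hρ]; field_simp
  refine ⟨ρ, hρ0, e1, e2, ?_⟩
  have hsq : u ^ 2 + v ^ 2 = ρ ^ 2 * (4 * Real.cos a ^ 2 + κ ^ 2 * Real.sin a ^ 2) := by
    have h3 := Real.sin_sq_add_cos_sq (a / κ)
    have h4 : u ^ 2 + v ^ 2 = (u * Real.cos (a / κ) + v * Real.sin (a / κ)) ^ 2 +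
        (-(u * Real.sin (a / κ)) + v * Real.cos (a / κ)) ^ 2 := by
      linear_combination -(u ^ 2 + v ^ 2) * h3
    rw [h4, e1, e2]; ring
  have hle : 4 * Real.cos a ^ 2 + κ ^ 2 * Real.sin a ^ 2 ≤ (2 + κ) ^ 2 := by
    nlinarith [Real.sin_sq_add_cos_sq a, sq_nonneg (Real.sin a), sq_nonneg (Real.cos a),
      sq_nonneg κ]
  refine le_of_sq_le_sq ?_ (by positivity)
  nlinarith [sq_nonneg v, mul_le_mul_of_nonneg_left hle (sq_nonneg ρ)]

theorem quadPart_smul (κ a t y₁ y₂ : ℝ) :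
    quadPart κ a (t * y₁) (t * y₂) = t ^ 2 * quadPart κ a y₁ y₂ := by
  unfold quadPart; ring

/-- The second-order upper expansion of the supersolution. It holds with one constant `K` because
everything is homogeneous; `ρ` is the length of the gradient at `(u, v)`, and `(y₁, y₂)` is the
displacement in the frame of the gradient. -/
theorem exists_expansion {κ b : ℝ} (hκ : 2 < κ ^ 2) (hκ0 : 0 < κ) (hb0 : 0 ≤ b)
    (hb : b < Real.pi / 2) :
    ∃ K N₀ : ℝ, 0 ≤ K ∧ 0 < N₀ ∧ ∀ u v a, 0 < u → |a| ≤ b →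
      polarAngle κ a = Real.arctan (v / u) → ∃ ρ, 0 < ρ ∧ u ≤ (2 + κ) * ρ ∧
        ∀ u' v' a' y₁ y₂ n, 0 < u' → |a'| ≤ b → polarAngle κ a' = Real.arctan (v' / u') →
          |Real.arctan (v' / u')| ≤ Real.pi / 2 * (1 - 1 / κ) →
          y₁ = (u' - u) * Real.cos (a / κ) + (v' - v) * Real.sin (a / κ) →
          y₂ = -((u' - u) * Real.sin (a / κ)) + (v' - v) * Real.cos (a / κ) →
          |y₁| ≤ n → |y₂| ≤ n → n ≤ N₀ * ρ →
          dualPot κ a' u' v' ≤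
            dualPot κ a u v + ρ * y₁ + quadPart κ a y₁ y₂ + K * n ^ 3 / ρ := by
  obtain ⟨K, N₀, hK, hN₀, H⟩ := exists_quadratic_bound hκ hκ0 hb0 hb
  refine ⟨K, N₀, hK, hN₀, fun u v a hu ha hθ => ?_⟩
  obtain ⟨ρ, hρ, e1, e2, hle⟩ := exists_frame hκ0 (ha.trans_lt hb) hu hθ
  refine ⟨ρ, hρ, hle, fun u' v' a' y₁ y₂ n hu' ha' hθ' hrange hy1 hy2 h1 h2 hn => ?_⟩
  have hc := cos_pos_of_abs_lt (ha.trans_lt hb)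
  obtain ⟨δ, hδ, hineq⟩ := H a (ρ⁻¹ * y₁) (ρ⁻¹ * y₂) (ρ⁻¹ * n) ha
    (by rw [abs_mul, abs_of_pos (inv_pos.2 hρ)]; gcongr)
    (by rw [abs_mul, abs_of_pos (inv_pos.2 hρ)]; gcongr)
    (by rw [inv_mul_le_iff₀ hρ]; linarith)
  refine (dualPot_le hκ hκ0 (ha'.trans_lt hb) hδ hu' hθ' hrange).trans ?_
  have e3 : (a + κ * δ) / κ = a / κ + δ := by field_simp
  have e4 : u' * Real.cos (a / κ + δ) + v' * Real.sin (a / κ + δ) =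
      ρ * ((2 * Real.cos a + ρ⁻¹ * y₁) * Real.cos δ +
        (-(κ * Real.sin a) + ρ⁻¹ * y₂) * Real.sin δ) := by
    have f1 : ρ * (2 * Real.cos a + ρ⁻¹ * y₁) =
        u' * Real.cos (a / κ) + v' * Real.sin (a / κ) := by
      rw [mul_add, mul_inv_cancel_left₀ hρ.ne', hy1]; linarith
    have f2 : ρ * (-(κ * Real.sin a) + ρ⁻¹ * y₂) =
        -(u' * Real.sin (a / κ)) + v' * Real.cos (a / κ) := by
      rw [mul_add, mul_inv_cancel_left₀ hρ.ne', hy2]; linarith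
    rw [Real.cos_add, Real.sin_add]
    linear_combination -Real.cos δ * f1 - Real.sin δ * f2
  have e5 : dualPot κ a u v = ρ ^ 2 * Real.cos a := by
    rw [dualPot, e1]; field_simp; ring
  rw [dualPot, e3, e4, mul_pow, mul_div_assoc, e5]
  calc _ ≤ ρ ^ 2 * (Real.cos a + ρ⁻¹ * y₁ + quadPart κ a (ρ⁻¹ * y₁) (ρ⁻¹ * y₂) +
        K * (ρ⁻¹ * n) ^ 3) := mul_le_mul_of_nonneg_left hineq (by positivity)
    _ = _ := by rw [quadPart_smul]; field_simp

/-- The mean of the second-order part after the noise has been added to the move `(v₁, v₂)`, for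
noise with `A = 1 + C₁₁` and `B = C₂₂`. -/
noncomputable def noisyQuad (κ a A B v₁ v₂ : ℝ) : ℝ :=
  A * quadPart κ a v₁ v₂ + B * quadPart κ a (-v₂) v₁

/-- The averaged second-order part has bounded coefficients, and it is uniformly negative along the
gradient exactly because `A (κ² / 2 - 1) < B`. -/
theorem exists_noisyQuad_coeff {κ b A B : ℝ} (hκ : 2 < κ ^ 2) (hκ0 : 0 < κ)
    (hb : b < Real.pi / 2) (hb0 : 0 ≤ b) (hA : 0 ≤ A) (hB : 0 ≤ B)
    (hAB : A * (κ ^ 2 / 2 - 1) < B) :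
    ∃ L c : ℝ, 0 ≤ L ∧ 0 < c ∧ ∀ a, |a| ≤ b → ∃ P R T : ℝ, |P| ≤ L ∧ |R| ≤ L ∧ |T| ≤ L ∧
      P ≤ -c ∧ ∀ v₁ v₂, noisyQuad κ a A B v₁ v₂ = P * v₁ ^ 2 + R * (v₁ * v₂) + T * v₂ ^ 2 := by
  set m := κ ^ 2 / 2 - 1 with hm
  have hm0 : 0 < m := by rw [hm]; linarith
  set k := Real.cos b with hk
  have hk0 : 0 < k := cos_pos_of_abs_lt (by rwa [abs_of_nonneg hb0])
  refine ⟨((A + B) * (m + κ / k + 1)) / (4 * (m * k)), (B - A * m) / (4 * (m + κ ^ 2 / (4 * k))),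
    by positivity, div_pos (by linarith) (by positivity), fun a ha => ?_⟩
  have hc : k ≤ Real.cos a := cos_le_cos_of_abs_le ha (by linarith [Real.pi_pos])
  have hc0 : 0 < Real.cos a := hk0.trans_le hc
  have hD := curv_lower hκ hb ha
  rw [← hm, ← hk] at hD
  have hD0 : 0 < curv κ a := (by positivity : 0 < m * k).trans_le hD
  have hDu : curv κ a ≤ m + κ ^ 2 / (4 * k) := by
    unfold curv
    rw [← hm]
    have h1 : m * Real.cos a ≤ m := by nlinarith [Real.cos_le_one a]
    have h2 : (κ * Real.sin a) ^ 2 / (4 * Real.cos a) ≤ κ ^ 2 / (4 * k) := by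
      refine div_le_div₀ (by positivity) ?_ (by positivity) (by linarith)
      nlinarith [Real.sin_sq_le_one a, sq_nonneg κ]
    linarith
  have hs : |κ * Real.sin a / Real.cos a| ≤ κ / k := by
    rw [abs_div, abs_mul, abs_of_pos hκ0, abs_of_pos hc0]
    exact div_le_div₀ hκ0.le (by nlinarith [Real.abs_sin_le_one a]) hk0 hc
  have bound : ∀ t : ℝ, |t| ≤ (A + B) * (m + κ / k + 1) →
      |t / (4 * curv κ a)| ≤ (A + B) * (m + κ / k + 1) / (4 * (m * k)) := by
    intro t ht
    rw [abs_div, abs_of_pos (by positivity : 0 < 4 * curv κ a)]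
    exact div_le_div₀ (by positivity) ht (by positivity) (by linarith)
  have hκk : 0 < κ / k := by positivity
  have hAm : 0 ≤ A * m := by positivity
  have hBm : 0 ≤ B * m := by positivity
  have hAk : 0 ≤ A * (κ / k) := by positivity
  have hBk : 0 ≤ B * (κ / k) := by positivity
  have hs' := abs_le.1 hs
  refine ⟨(A * m - B) / (4 * curv κ a), ((B - A) * (κ * Real.sin a / Real.cos a)) / (4 * curv κ a),
    (B * m - A) / (4 * curv κ a), bound _ ?_, bound _ ?_, bound _ ?_, ?_, fun v₁ v₂ => ?_⟩
  · rw [abs_le]; constructor <;> nlinarith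
  · rw [abs_le]; constructor <;> nlinarith
  · rw [abs_le]; constructor <;> nlinarith
  · rw [← neg_sub B, neg_div, neg_le_neg_iff]
    exact div_le_div_of_nonneg_left (by linarith) (by positivity) (by linarith)
  · unfold noisyQuad quadPart
    rw [← hm]
    ring

/-- One round of the linear-quadratic game: against the optimal move `(-ε, 0)`, no move of the
opponent gains more than the drift `P < 0` costs, once the gradient is large. -/
theorem game_round_le {P R T L c C ε ρ v₁ v₂ : ℝ} (hε : 0 < ε) (hL : 0 ≤ L) (hc : 0 < c)
    (hP : |P| ≤ L) (hR : |R| ≤ L) (hT : |T| ≤ L) (hPc : P ≤ -c)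
    (h1 : 8 * L * ε ≤ ρ) (h2 : (L ^ 2 + C) / c * ε ≤ ρ) (hρ : 0 < ρ)
    (hv : v₁ ^ 2 + v₂ ^ 2 ≤ ε ^ 2) :
    ρ * v₁ + (P * v₁ ^ 2 + R * (v₁ * v₂) + T * v₂ ^ 2) - ρ * ε + P * ε ^ 2 + C * ε ^ 3 / ρ ≤
      -(c * ε ^ 2) := by
  have hv1 : |v₁| ≤ ε := abs_le_of_sq_le_sq (by nlinarith [sq_nonneg v₂]) hε.le
  obtain ⟨hv1l, hv1u⟩ := abs_le.1 hv1
  have hd : 0 ≤ ε - v₁ := by linarith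
  have hdiff : ε ^ 2 - v₁ ^ 2 ≤ 2 * ε * (ε - v₁) := by nlinarith
  have hdiff0 : 0 ≤ ε ^ 2 - v₁ ^ 2 := by nlinarith [sq_nonneg v₂]
  have hv2 : v₂ ^ 2 ≤ 2 * ε * (ε - v₁) := by nlinarith
  have tP : P * v₁ ^ 2 ≤ P * ε ^ 2 + L * (2 * ε * (ε - v₁)) := by
    have : -P * (ε ^ 2 - v₁ ^ 2) ≤ L * (ε ^ 2 - v₁ ^ 2) :=
      mul_le_mul_of_nonneg_right ((neg_le_abs P).trans hP) hdiff0
    nlinarith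
  have tT : T * v₂ ^ 2 ≤ L * (2 * ε * (ε - v₁)) := by
    have : T * v₂ ^ 2 ≤ L * v₂ ^ 2 :=
      mul_le_mul_of_nonneg_right ((le_abs_self T).trans hT) (sq_nonneg _)
    nlinarith
  have tR : R * (v₁ * v₂) ≤ ρ / 2 * (ε - v₁) + L ^ 2 * ε ^ 3 / ρ := by
    have s1 : R * (v₁ * v₂) ≤ L * (ε * |v₂|) := by
      refine (le_abs_self _).trans ?_
      rw [abs_mul, abs_mul]
      gcongr
    have s2 : L * (ε * |v₂|) ≤ ρ / (4 * ε) * v₂ ^ 2 + L ^ 2 * ε ^ 3 / ρ := by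
      have : ρ / (4 * ε) * v₂ ^ 2 + L ^ 2 * ε ^ 3 / ρ - L * (ε * |v₂|) =
          (ρ * |v₂| - 2 * L * ε ^ 2) ^ 2 / (4 * ε * ρ) := by
        rw [← sq_abs v₂]; field_simp; ring
      have h0 : 0 ≤ (ρ * |v₂| - 2 * L * ε ^ 2) ^ 2 / (4 * ε * ρ) := by positivity
      linarith
    have s3 : ρ / (4 * ε) * v₂ ^ 2 ≤ ρ / 2 * (ε - v₁) := by
      calc ρ / (4 * ε) * v₂ ^ 2 ≤ ρ / (4 * ε) * (2 * ε * (ε - v₁)) := by gcongr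
        _ = _ := by field_simp; ring
    linarith
  have tC : L ^ 2 * ε ^ 3 / ρ + C * ε ^ 3 / ρ ≤ c * ε ^ 2 := by
    rw [div_mul_eq_mul_div, div_le_iff₀ hc] at h2
    rw [← add_div, div_le_iff₀ hρ]
    nlinarith [mul_le_mul_of_nonneg_right h2 (sq_nonneg ε)]
  have tL : 8 * L * ε * (ε - v₁) ≤ ρ * (ε - v₁) := mul_le_mul_of_nonneg_right h1 hd
  have hPε : P * ε ^ 2 ≤ -c * ε ^ 2 := mul_le_mul_of_nonneg_right hPc (sq_nonneg ε)
  linarith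

/-! ### Moments of the noise -/

section Noise

variable {μ : Measure Plane}

theorem IsNoise.ae_norm_le [IsProbabilityMeasure μ] (hμ : IsNoise μ) : ∀ᵐ x ∂μ, ‖x‖ ≤ reach μ - 1 := by
  obtain ⟨K, hK, hK0⟩ := hμ.compact_support
  set T := {R : ℝ | 0 < R ∧ μ (Metric.ball 0 R) = 1} with hT
  have hne : T.Nonempty := by
    obtain ⟨R, hR⟩ := hK.isBounded.subset_ball (0 : Plane)
    refine ⟨max R 1, by positivity, ?_⟩
    rw [prob_compl_eq_zero_iff Metric.isOpen_ball.measurableSet |>.symm]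
    refine measure_mono_null (Set.compl_subset_compl.2 ?_) hK0
    exact hR.trans (Metric.ball_subset_ball (le_max_left _ _))
  have hlt : ∀ n : ℕ, ∀ᵐ x ∂μ, ‖x‖ < sInf T + 1 / ((n : ℝ) + 1) := by
    intro n
    have hpos : (0 : ℝ) < 1 / ((n : ℝ) + 1) := by positivity
    obtain ⟨R, hR, hRlt⟩ := exists_lt_of_csInf_lt hne (lt_add_of_pos_right (sInf T) hpos)
    have h1 : ∀ᵐ x ∂μ, x ∈ Metric.ball (0 : Plane) R :=
      (mem_ae_iff_prob_eq_one Metric.isOpen_ball.measurableSet).2 hR.2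
    filter_upwards [h1] with x hx
    exact (mem_ball_zero_iff.1 hx).trans hRlt
  filter_upwards [ae_all_iff.2 hlt] with x hx
  have : reach μ - 1 = sInf T := by unfold reach; ring
  rw [this]
  refine le_of_forall_pos_lt_add fun e he => ?_
  obtain ⟨n, hn⟩ := exists_nat_one_div_lt he
  exact (hx n).trans (by linarith)

theorem one_le_reach : 1 ≤ reach μ := by
  unfold reach
  have : 0 ≤ sInf {R : ℝ | 0 < R ∧ μ (Metric.ball 0 R) = 1} :=
    Real.sInf_nonneg fun R hR => hR.1.le
  linarith

theorem IsNoise.integrable_of_continuous [IsProbabilityMeasure μ] (hμ : IsNoise μ) {f : Plane → ℝ} (hf : Continuous f) :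
    Integrable f μ := by
  obtain ⟨C, hC⟩ := (isCompact_closedBall (0 : Plane) (reach μ - 1)).exists_bound_of_continuousOn
    hf.continuousOn
  refine Integrable.of_bound hf.aestronglyMeasurable C ?_
  filter_upwards [hμ.ae_norm_le] with x hx
  exact hC x (mem_closedBall_zero_iff.2 hx)

theorem IsNoise.integral_coord [IsProbabilityMeasure μ] (hμ : IsNoise μ) (i : Fin 2) : ∫ x, x i ∂μ = 0 := by
  have hint : Integrable (fun x : Plane => x) μ := by
    refine Integrable.of_bound (by fun_prop) (reach μ - 1) ?_
    filter_upwards [hμ.ae_norm_le] with x hx using hx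
  have := (EuclideanSpace.proj (𝕜 := ℝ) i : Plane →L[ℝ] ℝ).integral_comp_comm hint
  simpa [hμ.mean_zero] using this

/-- The reflection in the first axis. -/
noncomputable def reflection : Plane ≃ₗᵢ[ℝ] Plane where
  toFun x := !₂[x 0, -x 1]
  invFun x := !₂[x 0, -x 1]
  map_add' x y := by ext i; fin_cases i <;> simp [add_comm]
  map_smul' c x := by ext i; fin_cases i <;> simp
  left_inv x := by ext i; fin_cases i <;> simp
  right_inv x := by ext i; fin_cases i <;> simp
  norm_map' x := by simp [EuclideanSpace.norm_eq, Fin.sum_univ_two]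

theorem IsNoise.integral_mul_coord (hμ : IsNoise μ) : ∫ x, x 0 * x 1 ∂μ = 0 := by
  have h := hμ.invariant reflection (by ext i; fin_cases i <;> simp [reflection, e₁])
  have h2 : ∫ x, x 0 * x 1 ∂μ = ∫ x, -(x 0 * x 1) ∂μ := by
    conv_lhs => rw [← h]
    rw [integral_map reflection.continuous.aemeasurable
      (Continuous.aestronglyMeasurable (by fun_prop))]
    simp [reflection]
  rw [integral_neg] at h2
  linarith

theorem IsNoise.integral_quadratic [IsProbabilityMeasure μ] (hμ : IsNoise μ) (a b c d e f : ℝ) :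
    ∫ x, (a + b * x 0 + c * x 1 + d * (x 0 * x 0) + e * (x 0 * x 1) + f * (x 1 * x 1)) ∂μ =
      a + d * cov μ 0 0 + f * cov μ 1 1 := by
  have I : ∀ {g : Plane → ℝ}, Continuous g → Integrable g μ := hμ.integrable_of_continuous
  rw [integral_add (I (by fun_prop)) (I (by fun_prop)),
    integral_add (I (by fun_prop)) (I (by fun_prop)),
    integral_add (I (by fun_prop)) (I (by fun_prop)),
    integral_add (I (by fun_prop)) (I (by fun_prop)),
    integral_add (I (by fun_prop)) (I (by fun_prop))]
  simp only [integral_const_mul, hμ.integral_coord, hμ.integral_mul_coord, cov]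
  simp

theorem norm_noiseMap (v x : Plane) : ‖noiseMap v x‖ = ‖v‖ * ‖x‖ := by
  simp only [EuclideanSpace.norm_eq, Fin.sum_univ_two, noiseMap]
  rw [← Real.sqrt_mul (by positivity)]
  congr 1
  simp
  ring

theorem cov_self_nonneg (i : Fin 2) : 0 ≤ cov μ i i :=
  integral_nonneg fun x => mul_self_nonneg (x i)

end Noise

/-! ### Lyapunov functions for the game -/

section Supermartingale

variable {μ : Measure Plane} {D : Set Plane} {ε : ℝ} [IsProbabilityMeasure μ]

theorem lintegral_gameLaw_succ (S₁ S₂ : Strategy μ D ε) (x₀ : Plane) (k : ℕ)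
    {f : Plane × Plane → ℝ≥0∞} (hf : Measurable f) :
    ∫⁻ h, f (h (k + 1)) ∂(gameLaw μ D ε S₁ S₂ x₀) =
      ∫⁻ h, ∫⁻ q, f q ∂(gameKernel μ D ε S₁ S₂ k (Preorder.frestrictLe k h))
        ∂(gameLaw μ D ε S₁ S₂ x₀) := by
  have hg : Measurable (fun h : FullHistory => f (h (k + 1))) :=
    hf.comp (measurable_pi_apply _)
  have h1 : ∀ h : History k,
      ∫⁻ g, f (g (k + 1)) ∂(Kernel.traj (X := fun _ => Plane × Plane)
        (gameKernel μ D ε S₁ S₂) k h) = ∫⁻ q, f q ∂(gameKernel μ D ε S₁ S₂ k h) := by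
    intro h
    rw [← Kernel.map_traj_succ_self (X := fun _ => Plane × Plane)
      (κ := gameKernel μ D ε S₁ S₂) (a := k), Kernel.map_apply _ (measurable_pi_apply _),
      lintegral_map hf (measurable_pi_apply _)]
  unfold gameLaw
  conv_lhs => rw [← Kernel.traj_comp_partialTraj (X := fun _ => Plane × Plane)
    (κ := gameKernel μ D ε S₁ S₂) (Nat.zero_le k)]
  rw [Kernel.lintegral_comp _ _ _ hg, ← Kernel.traj_map_frestrictLe_apply,
    lintegral_map (Measurable.lintegral_kernel hg) (Preorder.measurable_frestrictLe k)]
  simp_rw [h1]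

theorem endTime_le_tsum (h : FullHistory) :
    endTime D h ≤ ∑' k, (frontier D)ᶜ.indicator (fun _ => (1 : ℝ≥0∞)) (h k).2 := by
  by_cases hex : ∃ k, (h k).2 ∈ frontier D
  · classical
    set n := Nat.find hex
    have hn : (h n).2 ∈ frontier D := Nat.find_spec hex
    have hlt : ∀ k ∈ Finset.range n,
        (frontier D)ᶜ.indicator (fun _ => (1 : ℝ≥0∞)) (h k).2 = 1 := fun k hk =>
      Set.indicator_of_mem (Nat.find_min hex (Finset.mem_range.1 hk)) _
    calc endTime D h ≤ (n : ℝ≥0∞) := iInf₂_le n hn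
      _ = ∑ k ∈ Finset.range n, (frontier D)ᶜ.indicator (fun _ => (1 : ℝ≥0∞)) (h k).2 := by
        rw [Finset.sum_congr rfl hlt]; simp
      _ ≤ _ := ENNReal.sum_le_tsum _
  · push Not at hex
    have : ∀ k, (frontier D)ᶜ.indicator (fun _ => (1 : ℝ≥0∞)) (h k).2 = 1 := fun k =>
      Set.indicator_of_mem (hex k) _
    simp_rw [this]
    simp

/-- A Lyapunov function bounds the expected length of the game: if, whatever the history, one
step decreases the conditional expectation of `V` by at least `c` unless the game has ended, then
`c` times the expected end time is at most the initial value of `V`. -/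
theorem mul_expectedEndTime_le (S₁ S₂ : Strategy μ D ε) (x₀ : Plane) {V : Plane → ℝ≥0∞}
    (hV : Measurable V) (c : ℝ≥0∞)
    (hdrift : ∀ k (h : History k), ∫⁻ q, V q.2 ∂(gameKernel μ D ε S₁ S₂ k h) +
      c * (frontier D)ᶜ.indicator (fun _ => (1 : ℝ≥0∞)) h.pos ≤ V h.pos) :
    c * expectedEndTime μ D ε S₁ S₂ x₀ ≤ V x₀ := by
  set P := gameLaw μ D ε S₁ S₂ x₀ with hP
  set g : Plane → ℝ≥0∞ := (frontier D)ᶜ.indicator (fun _ => (1 : ℝ≥0∞)) with hg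
  have hgm : Measurable g := measurable_const.indicator isClosed_frontier.measurableSet.compl
  have hpm : ∀ k, Measurable (fun h : FullHistory => (h k).2) := fun k =>
    measurable_snd.comp (measurable_pi_apply k)
  have h0 : ∫⁻ h, V (h 0).2 ∂P = V x₀ := by
    have hm : Measurable (fun h : History 0 => V h.pos) := hV.comp (measurable_pos 0)
    have := lintegral_map (μ := P) hm (Preorder.measurable_frestrictLe 0)
    rw [hP, gameLaw, Kernel.traj_map_frestrictLe_apply, Kernel.partialTraj_self,
      Kernel.id_apply, lintegral_dirac' _ hm] at this
    exact this.symm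
  have hstep : ∀ k, ∫⁻ h, V (h (k + 1)).2 ∂P + c * ∫⁻ h, g (h k).2 ∂P ≤
      ∫⁻ h, V (h k).2 ∂P := by
    intro k
    have h := lintegral_gameLaw_succ S₁ S₂ x₀ k (hV.comp measurable_snd)
    simp only [Function.comp_apply, ← hP] at h
    have hgk : Measurable (fun h : FullHistory => g (h k).2) := hgm.comp (hpm k)
    rw [h, ← lintegral_const_mul _ hgk, ← lintegral_add_right _ (hgk.const_mul c)]
    exact lintegral_mono fun h => hdrift k (Preorder.frestrictLe k h)
  have hsum : ∀ n, ∫⁻ h, V (h n).2 ∂P + c * ∑ k ∈ Finset.range n, ∫⁻ h, g (h k).2 ∂P ≤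
      V x₀ := by
    intro n
    induction n with
    | zero => simp [h0]
    | succ n ih =>
      rw [Finset.sum_range_succ, mul_add, add_comm (c * _), ← add_assoc]
      exact (add_le_add_left (hstep n) _).trans ih
  calc c * expectedEndTime μ D ε S₁ S₂ x₀
      ≤ c * ∫⁻ h, ∑' k, g (h k).2 ∂P :=
        mul_le_mul_right (lintegral_mono fun h => endTime_le_tsum h) _
    _ = c * ∑' k, ∫⁻ h, g (h k).2 ∂P := by
        congr 1
        exact lintegral_tsum fun k => (hgm.comp (hpm k)).aemeasurable
    _ ≤ V x₀ := by
        rw [ENNReal.tsum_eq_iSup_nat, ENNReal.mul_iSup]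
        exact iSup_le fun n => le_add_self.trans (hsum n)

end Supermartingale

/-! ### Geometry of the wedge and the pulling strategy -/

/-- The distance of a point of the wedge to the lines that bound it, with a sign that makes it
positive exactly in the wedge. -/
noncomputable def gap (η : ℝ) (x : Plane) : ℝ :=
  x 0 * Real.sin (η / 2) - |x 1| * Real.cos (η / 2)

theorem pos_and_abs_arctan_lt {h u v : ℝ} (h0 : 0 < h) (hπ : h < Real.pi / 2)
    (huv : |v| * Real.cos h < u * Real.sin h) : 0 < u ∧ |Real.arctan (v / u)| < h := by
  have hs : 0 < Real.sin h := Real.sin_pos_of_pos_of_lt_pi h0 (by linarith)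
  have hc : 0 < Real.cos h := cos_pos_of_abs_lt (by rwa [abs_of_pos h0])
  have hu : 0 < u := by
    have : 0 < u * Real.sin h := lt_of_le_of_lt (by positivity) huv
    exact pos_of_mul_pos_left this hs.le
  refine ⟨hu, ?_⟩
  have hlt : |v / u| < Real.tan h := by
    rw [abs_div, abs_of_pos hu, Real.tan_eq_sin_div_cos, div_lt_div_iff₀ hu hc]
    linarith
  have hat : Real.arctan (Real.tan h) = h := Real.arctan_tan (by linarith) hπ
  rw [abs_lt] at hlt ⊢
  constructor
  · have := Real.arctan_strictMono hlt.1
    rwa [Real.arctan_neg, hat] at this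
  · have := Real.arctan_strictMono hlt.2
    rwa [hat] at this

section Wedge

variable {η : ℝ}

theorem mem_wedge_iff (h0 : 0 < η) (hπ : η < Real.pi) {x : Plane} :
    x ∈ wedge η ↔ 0 < gap η x := by
  have hs : 0 < Real.sin (η / 2) := Real.sin_pos_of_pos_of_lt_pi (by linarith) (by linarith)
  constructor
  · rintro ⟨r, hr, θ, h1, h2, rfl⟩
    have hsin : 0 < Real.sin (η / 2 - |θ|) :=
      Real.sin_pos_of_pos_of_lt_pi (by linarith [abs_lt.2 ⟨h1, h2⟩])
        (by linarith [abs_nonneg θ])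
    rw [Real.sin_sub, Real.cos_abs] at hsin
    have habs : |Real.sin θ| = Real.sin |θ| := by
      have hθ : |θ| ≤ Real.pi := by linarith [abs_lt.2 ⟨h1, h2⟩]
      rw [Real.abs_sin_eq_sin_abs_of_abs_le_pi hθ]
    simp only [gap, Matrix.cons_val_zero, Matrix.cons_val_one]
    rw [abs_mul, abs_of_pos hr, habs]
    nlinarith
  · intro hx
    obtain ⟨hu, hlt⟩ := pos_and_abs_arctan_lt (h := η / 2) (u := x 0) (v := x 1)
      (by linarith) (by linarith) (by unfold gap at hx; linarith)
    obtain ⟨r, hr, e1, e2⟩ := exists_polar hu (x 1)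
    refine ⟨r, hr, _, (abs_lt.1 hlt).1, (abs_lt.1 hlt).2, ?_⟩
    ext i
    fin_cases i
    · simpa using e1
    · simpa using e2

theorem continuous_gap (η : ℝ) : Continuous (gap η) := by
  unfold gap; fun_prop

theorem isOpen_wedge (h0 : 0 < η) (hπ : η < Real.pi) : IsOpen (wedge η) := by
  have : wedge η = gap η ⁻¹' Set.Ioi 0 := by ext x; exact mem_wedge_iff h0 hπ
  rw [this]
  exact isOpen_Ioi.preimage (continuous_gap η)

theorem mul_add_mul_le_norm (x : Plane) {a b : ℝ} (hab : a ^ 2 + b ^ 2 = 1) :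
    a * x 0 + b * x 1 ≤ ‖x‖ := by
  rw [EuclideanSpace.norm_eq, Fin.sum_univ_two]
  refine Real.le_sqrt_of_sq_le ?_
  simp only [Real.norm_eq_abs, sq_abs]
  nlinarith [sq_nonneg (a * x 1 - b * x 0)]

theorem abs_mul_add_mul_le_norm (x : Plane) {a b : ℝ} (hab : a ^ 2 + b ^ 2 = 1) :
    |a * x 0 + b * x 1| ≤ ‖x‖ := by
  refine abs_le.2 ⟨?_, mul_add_mul_le_norm x hab⟩
  have := mul_add_mul_le_norm x (a := -a) (b := -b) (by rw [neg_sq, neg_sq, hab])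
  linarith

theorem gap_sub_norm_le (h0 : 0 < η) (hπ : η < Real.pi) (x y : Plane) :
    gap η x - ‖y‖ ≤ gap η (x + y) := by
  have hc : 0 < Real.cos (η / 2) := cos_pos_of_abs_lt (by rw [abs_of_pos] <;> linarith)
  have hsc := Real.sin_sq_add_cos_sq (η / 2)
  have h1 := mul_add_mul_le_norm y (a := -Real.sin (η / 2)) (b := Real.cos (η / 2))
    (by rw [neg_sq, hsc])
  have h2 := mul_add_mul_le_norm y (a := -Real.sin (η / 2)) (b := -Real.cos (η / 2))
    (by rw [neg_sq, neg_sq, hsc])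
  have h3 : |x 1 + y 1| ≤ |x 1| + |y 1| := abs_add_le _ _
  have h4 : -Real.sin (η / 2) * y 0 + Real.cos (η / 2) * |y 1| ≤ ‖y‖ := by
    rcases abs_cases (y 1) with h | h <;> rw [h.1] <;> linarith
  simp only [gap, PiLp.add_apply]
  nlinarith

theorem mem_frontier_of_gap_eq_zero (h0 : 0 < η) (hπ : η < Real.pi) {y : Plane}
    (hy : gap η y = 0) : y ∈ frontier (wedge η) := by
  rw [(isOpen_wedge h0 hπ).frontier_eq]
  refine ⟨?_, fun h => by have := (mem_wedge_iff h0 hπ).1 h; linarith⟩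
  have hs : 0 < Real.sin (η / 2) := Real.sin_pos_of_pos_of_lt_pi (by linarith) (by linarith)
  have ht : Filter.Tendsto (fun t : ℝ => y + t • e₁) (nhdsWithin 0 (Set.Ioi 0)) (nhds y) := by
    have : Continuous fun t : ℝ => y + t • e₁ := by fun_prop
    simpa using (this.tendsto 0).mono_left nhdsWithin_le_nhds
  refine mem_closure_of_tendsto ht ?_
  filter_upwards [self_mem_nhdsWithin] with t ht
  rw [mem_wedge_iff h0 hπ]
  have : gap η (y + t • e₁) = gap η y + t * Real.sin (η / 2) := by
    simp [gap, e₁]; ring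
  rw [this, hy, zero_add]
  exact mul_pos ht hs

/-- The orthogonal projection to the nearer of the two sides of the wedge. -/
noncomputable def sideProj (η : ℝ) (x : Plane) : Plane :=
  !₂[x 0 - gap η x * Real.sin (η / 2),
    x 1 + (if 0 ≤ x 1 then 1 else -1) * (gap η x * Real.cos (η / 2))]

theorem measurable_sideProj (η : ℝ) : Measurable (sideProj η) := by
  have hg := (continuous_gap η).measurable
  have h0 : Measurable fun x : Plane => x 0 := by fun_prop
  have h1 : Measurable fun x : Plane => x 1 := by fun_prop
  have hite : Measurable fun x : Plane => if 0 ≤ x 1 then (1 : ℝ) else -1 :=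
    Measurable.ite (measurableSet_le measurable_const h1) measurable_const measurable_const
  refine (WithLp.measurable_toLp 2 _).comp (measurable_pi_iff.2 fun i => ?_)
  fin_cases i
  · exact h0.sub (hg.mul_const _)
  · exact h1.add (hite.mul (hg.mul_const _))

theorem gap_sideProj (hη : η < Real.pi) (h0 : 0 < η) {x : Plane} (hx : 0 ≤ gap η x) :
    gap η (sideProj η x) = 0 := by
  have hc : 0 < Real.cos (η / 2) := cos_pos_of_abs_lt (by rw [abs_of_pos] <;> linarith)
  have hsc := Real.sin_sq_add_cos_sq (η / 2)
  have hgc : 0 ≤ gap η x * Real.cos (η / 2) := by positivity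
  have habs : |sideProj η x 1| = |x 1| + gap η x * Real.cos (η / 2) := by
    have h1 : sideProj η x 1 =
        x 1 + (if 0 ≤ x 1 then 1 else -1) * (gap η x * Real.cos (η / 2)) := rfl
    rw [h1]
    split_ifs with h
    · rw [abs_of_nonneg h, one_mul, abs_of_nonneg (by linarith)]
    · rw [abs_of_neg (not_le.1 h), abs_of_neg (by linarith [not_le.1 h])]; ring
  have h00 : sideProj η x 0 = x 0 - gap η x * Real.sin (η / 2) := by simp [sideProj]
  have e : gap η (sideProj η x) =
      sideProj η x 0 * Real.sin (η / 2) - |sideProj η x 1| * Real.cos (η / 2) := rfl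
  have e' : gap η x = x 0 * Real.sin (η / 2) - |x 1| * Real.cos (η / 2) := rfl
  rw [e, habs, h00]
  linear_combination -gap η x * hsc - e'

theorem dist_sideProj {x : Plane} (hx : 0 ≤ gap η x) :
    dist (sideProj η x) x = gap η x := by
  rw [EuclideanSpace.dist_eq, Fin.sum_univ_two]
  have hs : (if 0 ≤ x 1 then (1 : ℝ) else -1) ^ 2 = 1 := by split_ifs <;> norm_num
  have : dist (sideProj η x 0) (x 0) ^ 2 + dist (sideProj η x 1) (x 1) ^ 2 = gap η x ^ 2 := by
    simp only [Real.dist_eq, sq_abs, sideProj, PiLp.toLp_apply, Matrix.cons_val_zero,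
      Matrix.cons_val_one]
    linear_combination gap η x ^ 2 * Real.sin_sq_add_cos_sq (η / 2) +
      gap η x ^ 2 * Real.cos (η / 2) ^ 2 * hs
  rw [this, Real.sqrt_sq hx]

/-- In the wedge the distance to the boundary is `gap η`: the projection to the nearer side lands on
the boundary, because the opening angle is less than `π`. -/
theorem infDist_frontier_wedge (h0 : 0 < η) (hπ : η < Real.pi) {x : Plane} (hx : x ∈ wedge η) :
    Metric.infDist x (frontier (wedge η)) = gap η x := by
  have hg := ((mem_wedge_iff h0 hπ).1 hx).le
  have hmem := mem_frontier_of_gap_eq_zero h0 hπ (gap_sideProj hπ h0 hg)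
  refine le_antisymm ?_ ((Metric.le_infDist ⟨_, hmem⟩).2 fun y hy => ?_)
  · rw [← dist_sideProj hg, dist_comm]
    exact Metric.infDist_le_dist_of_mem hmem
  · have hy0 : gap η y ≤ 0 := by
      rw [(isOpen_wedge h0 hπ).frontier_eq] at hy
      exact not_lt.1 fun h => hy.2 ((mem_wedge_iff h0 hπ).2 h)
    have := gap_sub_norm_le h0 hπ x (y - x)
    rw [add_sub_cancel, ← dist_eq_norm, dist_comm] at this
    linarith

/-- The strategy that always pulls against the direction of angle `dir x` with full strength,
and leaves through the nearest boundary point. -/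
noncomputable def pullStrategy (μ : Measure Plane) (h0 : 0 < η) (hπ : η < Real.pi)
    {dir : Plane → ℝ} (hdir : Measurable dir) {ε : ℝ} (hε : 0 < ε) :
    Strategy μ (wedge η) ε where
  move _ h := !₂[-(ε * Real.cos (dir h.pos)), -(ε * Real.sin (dir h.pos))]
  measurable_move k := by
    have hd : Measurable fun h : History k => dir h.pos := hdir.comp (measurable_pos k)
    refine (WithLp.measurable_toLp 2 _).comp (measurable_pi_iff.2 fun i => ?_)
    fin_cases i
    · exact (hd.cos.const_mul ε).neg
    · exact (hd.sin.const_mul ε).neg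
  norm_move_le k h := by
    rw [EuclideanSpace.norm_eq, Fin.sum_univ_two]
    refine Real.sqrt_le_iff.2 ⟨hε.le, ?_⟩
    simp only [Matrix.cons_val_zero, Matrix.cons_val_one, Real.norm_eq_abs, sq_abs]
    nlinarith [Real.sin_sq_add_cos_sq (dir h.pos)]
  exit _ h := sideProj η h.pos
  measurable_exit k := (measurable_sideProj η).comp (measurable_pos k)
  exit_mem k h hx hle := by
    have hg := ((mem_wedge_iff h0 hπ).1 hx).le
    rw [infDist_frontier_wedge h0 hπ hx] at hle
    exact ⟨mem_frontier_of_gap_eq_zero h0 hπ (gap_sideProj hπ h0 hg),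
      (dist_sideProj hg).trans_le hle⟩

end Wedge

/-- A quadratic bound in the coordinates of the unscaled noise can be integrated: the linear terms
and the mixed term have mean zero. -/
theorem lintegral_noiseAt_le {μ : Measure Plane} [IsProbabilityMeasure μ] (hμ : IsNoise μ)
    (w : Plane) {F : Plane → ℝ≥0∞} (hF : Measurable F) {a b c d e f : ℝ}
    (h : ∀ x : Plane, ‖x‖ ≤ reach μ - 1 →
      0 ≤ a + b * x 0 + c * x 1 + d * (x 0 * x 0) + e * (x 0 * x 1) + f * (x 1 * x 1) ∧
      F (noiseMap w x) ≤ ENNReal.ofReal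
        (a + b * x 0 + c * x 1 + d * (x 0 * x 0) + e * (x 0 * x 1) + f * (x 1 * x 1))) :
    0 ≤ a + d * cov μ 0 0 + f * cov μ 1 1 ∧
      ∫⁻ z, F z ∂(noiseAt μ w) ≤ ENNReal.ofReal (a + d * cov μ 0 0 + f * cov μ 1 1) := by
  have hnn : ∀ᵐ x ∂μ, 0 ≤ a + b * x 0 + c * x 1 + d * (x 0 * x 0) + e * (x 0 * x 1) +
      f * (x 1 * x 1) := by
    filter_upwards [hμ.ae_norm_le] with x hx using (h x hx).1
  refine ⟨hμ.integral_quadratic a b c d e f ▸ integral_nonneg_of_ae hnn, ?_⟩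
  rw [noiseAt, lintegral_map hF (measurable_noiseMap_right w), ← hμ.integral_quadratic a b c d e f,
    ofReal_integral_eq_lintegral_ofReal (hμ.integrable_of_continuous (by fun_prop)) hnn]
  refine lintegral_mono_ae ?_
  filter_upwards [hμ.ae_norm_le] with x hx using (h x hx).2

theorem lintegral_gameKernel {μ : Measure Plane} [IsProbabilityMeasure μ] {D : Set Plane} {ε : ℝ}
    (S₁ S₂ : Strategy μ D ε) (k : ℕ) (h : History k) (f : Plane × Plane → ℝ≥0∞) :
    ∫⁻ q, f q ∂(gameKernel μ D ε S₁ S₂ k h) =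
      2⁻¹ * ∫⁻ q, f q ∂(winLaw μ D ε S₁ k h) + 2⁻¹ * ∫⁻ q, f q ∂(winLaw μ D ε S₂ k h) := by
  change ∫⁻ q, f q ∂((2⁻¹ : ℝ≥0∞) • winLaw μ D ε S₁ k h + (2⁻¹ : ℝ≥0∞) • winLaw μ D ε S₂ k h) = _
  rw [lintegral_add_measure, lintegral_smul_measure, lintegral_smul_measure]
  rfl

/-- The condition on `η` leaves room for a frequency `κ` that is subcritical for the operator but
whose wedge, of half angle `π / 2 * (1 - 1 / κ)`, is still wider than the given one. -/
theorem exists_hodograph_frequency {A B η : ℝ} (hA : 0 < A) (hB : 0 < B)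
    (hη : η < Real.pi * (1 - 1 / 2 * Real.sqrt (2 * A / (A + B)))) :
    ∃ κ : ℝ, 0 < κ ∧ 2 < κ ^ 2 ∧ A * (κ ^ 2 / 2 - 1) < B ∧
      η / 2 < Real.pi / 2 * (1 - 1 / κ) := by
  set t := 1 / 2 * Real.sqrt (2 * A / (A + B)) with ht
  have ht0 : 0 < t := by positivity
  have ht2 : t ^ 2 = A / (2 * (A + B)) := by
    rw [ht, mul_pow, Real.sq_sqrt (by positivity)]; field_simp
  have h1 : t < Real.sqrt (1 / 2) := by
    refine Real.lt_sqrt_of_sq_lt ?_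
    rw [ht2, div_lt_div_iff₀ (by positivity) (by norm_num)]
    linarith
  have h2 : t < 1 - η / Real.pi := by
    rw [lt_sub_comm, div_lt_iff₀ Real.pi_pos]; linarith
  obtain ⟨τ, hτ1, hτ2⟩ := exists_between (lt_min h1 h2)
  have hτ0 : 0 < τ := ht0.trans hτ1
  have hτs : τ ^ 2 < 1 / 2 :=
    (Real.lt_sqrt hτ0.le).1 (hτ2.trans_le (min_le_left _ _))
  have hτη : τ < 1 - η / Real.pi := hτ2.trans_le (min_le_right _ _)
  refine ⟨1 / τ, by positivity, ?_, ?_, ?_⟩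
  · rw [div_pow, one_pow, lt_div_iff₀ (by positivity)]; linarith
  · have h3 : A / (2 * (A + B)) < τ ^ 2 := by rw [← ht2]; gcongr
    rw [div_lt_iff₀ (by positivity)] at h3
    have h4 : A * ((1 / τ) ^ 2 / 2 - 1) = (A - 2 * A * τ ^ 2) / (2 * τ ^ 2) := by field_simp
    rw [h4, div_lt_iff₀ (by positivity)]
    linarith
  · rw [one_div_one_div]
    rw [lt_sub_comm, div_lt_iff₀ Real.pi_pos] at hτη
    linarith

/-! ### The drift of the translated supersolution -/

/-- The supersolution, translated by `s` against the axis of the wedge; `sel` computes the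
hodograph parameter from the polar angle. The translation keeps the singularity at the vertex
away from the wedge. -/
noncomputable def shiftedPot (κ : ℝ) (sel : ℝ → ℝ) (s : ℝ) (x : Plane) : ℝ :=
  dualPot κ (sel (Real.arctan (x 1 / (x 0 + s)))) (x 0 + s) (x 1)

theorem measurable_shiftedPot (κ : ℝ) {sel : ℝ → ℝ} (hsel : Measurable sel) (s : ℝ) :
    Measurable (shiftedPot κ sel s) := by
  have hs : Measurable fun x : Plane => sel (Real.arctan (x 1 / (x 0 + s))) := by fun_prop
  unfold shiftedPot dualPot
  fun_prop

open Classical in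
/-- The Lyapunov function of the game: the supersolution plus `c` in the domain, `0` where the
game has ended, and `∞` at the points that cannot be reached. -/
noncomputable def lyapunov (D : Set Plane) (U : Plane → ℝ) (c : ℝ) (x : Plane) : ℝ≥0∞ :=
  if x ∈ frontier D then 0 else if x ∈ D then ENNReal.ofReal (U x + c) else ⊤

theorem measurable_lyapunov {D : Set Plane} (hD : MeasurableSet D) {U : Plane → ℝ}
    (hU : Measurable U) (c : ℝ) : Measurable (lyapunov D U c) := by
  unfold lyapunov
  exact Measurable.ite isClosed_frontier.measurableSet measurable_const
    (Measurable.ite hD (hU.add_const c).ennreal_ofReal measurable_const)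

theorem quadPart_noise (κ a w₁ w₂ s t : ℝ) :
    quadPart κ a ((1 + s) * w₁ - t * w₂) ((1 + s) * w₂ + t * w₁) =
      quadPart κ a w₁ w₂ + 2 * quadPart κ a w₁ w₂ * s +
        (quadPart κ a (w₁ - w₂) (w₂ + w₁) - quadPart κ a w₁ w₂ - quadPart κ a (-w₂) w₁) * t +
        quadPart κ a w₁ w₂ * (s * s) +
        (quadPart κ a (w₁ - w₂) (w₂ + w₁) - quadPart κ a w₁ w₂ - quadPart κ a (-w₂) w₁) * (s * t) +
        quadPart κ a (-w₂) w₁ * (t * t) := by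
  unfold quadPart
  ring

/-- The drift of the supersolution `U s`, translated by `s = M ε`. For a move `w` from `x`, the
number `E w` bounds the mean of `U` at the next position. If the opponent of the player who moves
by `w` pulls against the direction `dir`, which is that of the gradient, then the average of the
two bounds is smaller than `U x` by at least `c ε² / 2`. -/
theorem exists_supersolution {μ : Measure Plane} [IsProbabilityMeasure μ] (hμ : IsNoise μ)
    (hC : 0 < cov μ 1 1) {η : ℝ} (h0 : 0 < η) (hπ : η < Real.pi)
    (hη : η < Real.pi * (1 - 1 / 2 *
      Real.sqrt (2 * (1 + cov μ 0 0) / (1 + cov μ 0 0 + cov μ 1 1)))) :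
    ∃ (M c : ℝ) (U dir : ℝ → Plane → ℝ), 0 < M ∧ 0 < c ∧ (∀ s, Measurable (U s)) ∧
      (∀ s, Measurable (dir s)) ∧ (∀ s x, 0 < s → x ∈ wedge η → 0 ≤ U s x) ∧
      (∀ s x, 0 < s → x ∈ wedge η → U s x ≤ (x 0 + s) ^ 2 / 4) ∧
      ∀ ε, 0 < ε → ∀ x ∈ wedge η, reach μ * ε < gap η x → ∃ E : Plane → ℝ,
        (∀ w, ‖w‖ ≤ ε → 0 ≤ E w ∧ ∀ C, 0 ≤ C →
          ∫⁻ z, lyapunov (wedge η) (U (M * ε)) C (x + w + z) ∂(noiseAt μ w) ≤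
            ENNReal.ofReal (E w + C)) ∧
        ∀ w, ‖w‖ ≤ ε →
          E w + E !₂[-(ε * Real.cos (dir (M * ε) x)), -(ε * Real.sin (dir (M * ε) x))] ≤
            2 * U (M * ε) x - c * ε ^ 2 := by
  set A := 1 + cov μ 0 0 with hA
  set B := cov μ 1 1 with hB
  have hA0 : 0 < A := by have := cov_self_nonneg (μ := μ) 0; linarith
  obtain ⟨κ, hκ0, hκ, hAB, hηκ⟩ := exists_hodograph_frequency hA0 hC hη
  obtain ⟨b, hb0, hb, hbη⟩ := exists_le_polarAngle_neg hκ0 hηκ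
  obtain ⟨sel, hselm, hsel⟩ := exists_measurable_polarAngle_inverse (κ := κ) hb0 hb hbη
  obtain ⟨K, N₀, hK, hN₀, hexp⟩ := exists_expansion hκ hκ0 hb0 hb
  obtain ⟨L, c, hL, hc, hcoef⟩ := exists_noisyQuad_coeff hκ hκ0 hb hb0 hA0.le hC.le hAB
  have hα : 1 ≤ reach μ := one_le_reach
  set α := reach μ with hαd
  have hα0 : 0 < α := by linarith
  set M := (2 + κ) * (8 * L + (L ^ 2 + 2 * (K * α ^ 3)) / c + α / N₀ + 1) with hM
  have hM0 : 0 < M := by positivity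
  have hcone : ∀ s (x : Plane), 0 < s → 0 < gap η x →
      0 < x 0 + s ∧ |Real.arctan (x 1 / (x 0 + s))| < η / 2 := by
    intro s x hs hx
    have hsin : 0 < Real.sin (η / 2) := Real.sin_pos_of_pos_of_lt_pi (by linarith) (by linarith)
    refine pos_and_abs_arctan_lt (by linarith) (by linarith) ?_
    unfold gap at hx
    nlinarith
  have hpar : ∀ s (x : Plane), 0 < s → 0 < gap η x →
      |sel (Real.arctan (x 1 / (x 0 + s)))| ≤ b ∧
        polarAngle κ (sel (Real.arctan (x 1 / (x 0 + s)))) = Real.arctan (x 1 / (x 0 + s)) :=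
    fun s x hs hx => hsel _ (hcone s x hs hx).2.le
  refine ⟨M, c, shiftedPot κ sel, fun s x => sel (Real.arctan (x 1 / (x 0 + s))) / κ, hM0, hc,
    measurable_shiftedPot κ hselm, fun s => by fun_prop, ?_, ?_, ?_⟩
  · intro s x hs hx
    have hx' := (mem_wedge_iff h0 hπ).1 hx
    have := cos_pos_of_abs_lt ((hpar s x hs hx').1.trans_lt hb)
    unfold shiftedPot dualPot
    positivity
  · intro s x hs hx
    have hx' := (mem_wedge_iff h0 hπ).1 hx
    have h1 := hpar s x hs hx'
    have h2 := hcone s x hs hx'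
    have := dualPot_le hκ hκ0 (h1.1.trans_lt hb) (a' := 0) (by simp [Real.pi_pos]) h2.1 h1.2
      (h2.2.trans hηκ).le
    simpa [dualPot, shiftedPot] using this
  intro ε hε x hx hgap
  have hx' := (mem_wedge_iff h0 hπ).1 hx
  set s := M * ε with hs
  have hs0 : 0 < s := by positivity
  obtain ⟨ha, hpa⟩ := hpar s x hs0 hx'
  have hu := (hcone s x hs0 hx').1
  set a := sel (Real.arctan (x 1 / (x 0 + s))) with had
  obtain ⟨ρ, hρ, hρu, hstep⟩ := hexp (x 0 + s) (x 1) a hu ha hpa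
  obtain ⟨P, R, T, hP, hR, hT, hPc, hquad⟩ := hcoef a ha
  have hx0 : 0 < x 0 := by
    have := (pos_and_abs_arctan_lt (h := η / 2) (u := x 0) (v := x 1) (by linarith)
      (by linarith) (by unfold gap at hx'; linarith)).1
    exact this
  -- the gradient is large compared to the step size
  have hρM : (8 * L + (L ^ 2 + 2 * (K * α ^ 3)) / c + α / N₀ + 1) * ε ≤ ρ := by
    have : (2 + κ) * ((8 * L + (L ^ 2 + 2 * (K * α ^ 3)) / c + α / N₀ + 1) * ε) ≤
        (2 + κ) * ρ := by
      calc _ = s := by rw [hs, hM]; ring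
        _ ≤ x 0 + s := by linarith
        _ ≤ _ := hρu
    exact le_of_mul_le_mul_left this (by positivity)
  have p1 : 0 ≤ 8 * L * ε := by positivity
  have p2 : 0 ≤ (L ^ 2 + 2 * (K * α ^ 3)) / c * ε := by positivity
  have p3 : 0 ≤ α / N₀ * ε := by positivity
  have hr1 : 8 * L * ε ≤ ρ := by linarith
  have hr2 : (L ^ 2 + 2 * (K * α ^ 3)) / c * ε ≤ ρ := by linarith
  have hr3 : α * ε ≤ N₀ * ρ := by
    have : α / N₀ * ε ≤ ρ := by linarith
    rw [div_mul_eq_mul_div, div_le_iff₀ hN₀] at this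
    linarith
  -- coordinates of a vector in the frame of the gradient
  set f₁ : Plane → ℝ := fun w => w 0 * Real.cos (a / κ) + w 1 * Real.sin (a / κ) with hf₁
  set f₂ : Plane → ℝ := fun w => -(w 0 * Real.sin (a / κ)) + w 1 * Real.cos (a / κ) with hf₂
  have hsc := Real.sin_sq_add_cos_sq (a / κ)
  have hf₁n : ∀ w, |f₁ w| ≤ ‖w‖ := fun w => by
    have := abs_mul_add_mul_le_norm w (a := Real.cos (a / κ)) (b := Real.sin (a / κ))
      (by linarith)
    rwa [mul_comm, mul_comm (Real.sin _)] at this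
  have hf₂n : ∀ w, |f₂ w| ≤ ‖w‖ := fun w => by
    have := abs_mul_add_mul_le_norm w (a := -Real.sin (a / κ)) (b := Real.cos (a / κ))
      (by rw [neg_sq]; exact hsc)
    rwa [neg_mul, mul_comm, mul_comm (Real.cos _)] at this
  set U := shiftedPot κ sel s with hU
  set E : Plane → ℝ := fun w =>
    U x + ρ * f₁ w + noisyQuad κ a A B (f₁ w) (f₂ w) + K * (α * ε) ^ 3 / ρ with hE
  -- the expansion after the move `w` and the unscaled noise `ζ`
  have hpoint : ∀ w : Plane, ‖w‖ ≤ ε → ∀ ζ : Plane, ‖ζ‖ ≤ α - 1 →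
      x + w + noiseMap w ζ ∈ wedge η ∧ U (x + w + noiseMap w ζ) ≤
        U x + ρ * ((1 + ζ 0) * f₁ w - ζ 1 * f₂ w) +
          quadPart κ a ((1 + ζ 0) * f₁ w - ζ 1 * f₂ w) ((1 + ζ 0) * f₂ w + ζ 1 * f₁ w) +
          K * (α * ε) ^ 3 / ρ := by
    intro w hw ζ hζ
    have hn : ‖w + noiseMap w ζ‖ ≤ α * ε := by
      calc ‖w + noiseMap w ζ‖ ≤ ‖w‖ + ‖w‖ * ‖ζ‖ := by
            rw [← norm_noiseMap]; exact norm_add_le _ _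
        _ ≤ ε + ε * (α - 1) := by gcongr
        _ = α * ε := by ring
    have hgap' : 0 < gap η (x + w + noiseMap w ζ) := by
      have := gap_sub_norm_le h0 hπ x (w + noiseMap w ζ)
      rw [← add_assoc] at this
      linarith
    refine ⟨(mem_wedge_iff h0 hπ).2 hgap', ?_⟩
    have hp' := hpar s _ hs0 hgap'
    have hc' := hcone s _ hs0 hgap'
    have e1 : (1 + ζ 0) * f₁ w - ζ 1 * f₂ w = f₁ (w + noiseMap w ζ) := by
      simp [hf₁, hf₂, noiseMap]; ring
    have e2 : (1 + ζ 0) * f₂ w + ζ 1 * f₁ w = f₂ (w + noiseMap w ζ) := by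
      simp [hf₁, hf₂, noiseMap]; ring
    rw [e1, e2]
    refine hstep _ _ _ (f₁ (w + noiseMap w ζ)) (f₂ (w + noiseMap w ζ)) (α * ε) hc'.1 hp'.1 hp'.2
      (hc'.2.trans hηκ).le ?_ ?_ ((hf₁n _).trans hn) ((hf₂n _).trans hn) hr3
    · simp [hf₁]; ring
    · simp [hf₂]; ring
  have hUnn : ∀ y ∈ wedge η, 0 ≤ U y := by
    intro y hy
    have := cos_pos_of_abs_lt ((hpar s y hs0 ((mem_wedge_iff h0 hπ).1 hy)).1.trans_lt hb)
    rw [hU]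
    unfold shiftedPot dualPot
    positivity
  have hlint : ∀ w : Plane, ‖w‖ ≤ ε → ∀ C, 0 ≤ C → 0 ≤ E w + C ∧
      ∫⁻ z, lyapunov (wedge η) U C (x + w + z) ∂(noiseAt μ w) ≤ ENNReal.ofReal (E w + C) := by
    intro w hw C hC0
    have hmeas : Measurable fun z => lyapunov (wedge η) U C (x + w + z) :=
      (measurable_lyapunov (isOpen_wedge h0 hπ).measurableSet
        (measurable_shiftedPot κ hselm s) C).comp (measurable_const_add _)
    set q := quadPart κ a (f₁ w) (f₂ w) with hq
    set q' := quadPart κ a (-f₂ w) (f₁ w) with hq'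
    set X := quadPart κ a (f₁ w - f₂ w) (f₂ w + f₁ w) - q - q' with hX
    have key := lintegral_noiseAt_le hμ w hmeas
      (a := U x + ρ * f₁ w + q + K * (α * ε) ^ 3 / ρ + C) (b := ρ * f₁ w + 2 * q)
      (c := -(ρ * f₂ w) + X) (d := q) (e := X) (f := q') ?_
    · have hEC : E w + C = U x + ρ * f₁ w + q + K * (α * ε) ^ 3 / ρ + C + q * cov μ 0 0 +
          q' * cov μ 1 1 := by
        rw [hE]
        simp only [noisyQuad, ← hq, ← hq', hA, hB]
        ring
      rwa [hEC]
    · intro ζ hζ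
      obtain ⟨hmem, hle⟩ := hpoint w hw ζ hζ
      rw [quadPart_noise, ← hq, ← hq', ← hX] at hle
      have hle' : U (x + w + noiseMap w ζ) + C ≤
          U x + ρ * f₁ w + q + K * (α * ε) ^ 3 / ρ + C + (ρ * f₁ w + 2 * q) * ζ 0 +
            (-(ρ * f₂ w) + X) * ζ 1 + q * (ζ 0 * ζ 0) + X * (ζ 0 * ζ 1) + q' * (ζ 1 * ζ 1) := by
        linarith
      refine ⟨le_trans (add_nonneg (hUnn _ hmem) hC0) hle', ?_⟩
      have hnf : x + w + noiseMap w ζ ∉ frontier (wedge η) := by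
        rw [(isOpen_wedge h0 hπ).frontier_eq]
        exact fun h => h.2 hmem
      rw [lyapunov, if_neg hnf, if_pos hmem]
      exact ENNReal.ofReal_le_ofReal hle'
  refine ⟨E, fun w hw => ⟨by simpa using (hlint w hw 0 le_rfl).1,
    fun C hC0 => (hlint w hw C hC0).2⟩, fun w hw => ?_⟩
  set w' : Plane := !₂[-(ε * Real.cos (a / κ)), -(ε * Real.sin (a / κ))] with hw'
  have g1 : f₁ w' = -ε := by
    simp only [hf₁, hw', Matrix.cons_val_zero, Matrix.cons_val_one]
    linear_combination -ε * hsc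
  have g2 : f₂ w' = 0 := by
    simp only [hf₂, hw', Matrix.cons_val_zero, Matrix.cons_val_one]
    ring
  have hsq : f₁ w ^ 2 + f₂ w ^ 2 ≤ ε ^ 2 := by
    have h1 : f₁ w ^ 2 + f₂ w ^ 2 = ‖w‖ ^ 2 := by
      rw [EuclideanSpace.norm_sq_eq, Fin.sum_univ_two]
      simp only [hf₁, hf₂, Real.norm_eq_abs, sq_abs]
      linear_combination (w 0 ^ 2 + w 1 ^ 2) * hsc
    rw [h1]
    gcongr
  have hround := game_round_le (v₁ := f₁ w) (v₂ := f₂ w) hε hL hc hP hR hT hPc hr1 hr2 hρ hsq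
  have hEw : E w + E w' = 2 * U x + (ρ * f₁ w + (P * f₁ w ^ 2 + R * (f₁ w * f₂ w) +
      T * f₂ w ^ 2) - ρ * ε + P * ε ^ 2 + 2 * (K * α ^ 3) * ε ^ 3 / ρ) := by
    simp only [hE, hquad, g1, g2]
    ring
  rw [hEw]
  linarith

/-- One step of the game decreases the Lyapunov function in the mean, whatever the history. -/
theorem lyapunov_drift {μ : Measure Plane} [IsProbabilityMeasure μ] {D : Set Plane}
    (hD : IsOpen D) {ε c : ℝ} (hc : 0 ≤ c) {U : Plane → ℝ} (hU : Measurable U)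
    (hU0 : ∀ x ∈ D, 0 ≤ U x) (S₁ S₂ : Strategy μ D ε)
    (hstep : ∀ k (h : History k), h.pos ∈ D → reach μ * ε < Metric.infDist h.pos (frontier D) →
      ∃ E : Plane → ℝ,
        (∀ w, ‖w‖ ≤ ε → 0 ≤ E w ∧
          ∫⁻ z, lyapunov D U c (h.pos + w + z) ∂(noiseAt μ w) ≤ ENNReal.ofReal (E w + c)) ∧
        E (S₁.move k h) + E (S₂.move k h) ≤ 2 * U h.pos - 2 * c)
    (k : ℕ) (h : History k) :
    ∫⁻ q, lyapunov D U c q.2 ∂(gameKernel μ D ε S₁ S₂ k h) +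
      ENNReal.ofReal c * (frontier D)ᶜ.indicator (fun _ => (1 : ℝ≥0∞)) h.pos ≤
        lyapunov D U c h.pos := by
  have hV := measurable_lyapunov hD.measurableSet hU c
  have hV2 : Measurable fun q : Plane × Plane => lyapunov D U c q.2 := hV.comp measurable_snd
  have hzero : ∀ y ∈ frontier D, lyapunov D U c y = 0 := fun y hy => if_pos hy
  rw [lintegral_gameKernel]
  by_cases hf : h.pos ∈ frontier D
  · simp only [winLaw, if_pos hf]
    rw [lintegral_dirac' _ hV2]
    simp [hzero _ hf, hf]
  rw [Set.indicator_of_mem (show h.pos ∈ (frontier D)ᶜ from hf), mul_one]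
  by_cases hmem : h.pos ∈ D
  swap
  · have : lyapunov D U c h.pos = ⊤ := by rw [lyapunov, if_neg hf, if_neg hmem]
    rw [this]; exact le_top
  have hval : lyapunov D U c h.pos = ENNReal.ofReal (U h.pos + c) := by
    rw [lyapunov, if_neg hf, if_pos hmem]
  rw [hval]
  by_cases hfar : reach μ * ε < Metric.infDist h.pos (frontier D)
  · obtain ⟨E, hE, hsum⟩ := hstep k h hmem hfar
    have hwin : ∀ S : Strategy μ D ε, ∫⁻ q, lyapunov D U c q.2 ∂(winLaw μ D ε S k h) ≤
        ENNReal.ofReal (E (S.move k h) + c) := by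
      intro S
      simp only [winLaw, if_neg hf, if_pos hfar]
      rw [lintegral_map hV2 (by fun_prop)]
      exact (hE _ (S.norm_move_le k h)).2
    have h1 := (hE _ (S₁.norm_move_le k h)).1
    have h2 := (hE _ (S₂.norm_move_le k h)).1
    have hhalf : (2⁻¹ : ℝ≥0∞) = ENNReal.ofReal 2⁻¹ := by
      rw [ENNReal.ofReal_inv_of_pos two_pos]; simp
    calc _ ≤ 2⁻¹ * ENNReal.ofReal (E (S₁.move k h) + c) +
          2⁻¹ * ENNReal.ofReal (E (S₂.move k h) + c) + ENNReal.ofReal c := by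
          gcongr
          · exact hwin S₁
          · exact hwin S₂
      _ = ENNReal.ofReal (2⁻¹ * (E (S₁.move k h) + c) + 2⁻¹ * (E (S₂.move k h) + c) + c) := by
          rw [hhalf, ← ENNReal.ofReal_mul (by norm_num), ← ENNReal.ofReal_mul (by norm_num),
            ← ENNReal.ofReal_add (by positivity) (by positivity),
            ← ENNReal.ofReal_add (by positivity) hc]
      _ ≤ _ := ENNReal.ofReal_le_ofReal (by linarith)
  · have hwin : ∀ S : Strategy μ D ε, ∫⁻ q, lyapunov D U c q.2 ∂(winLaw μ D ε S k h) = 0 := by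
      intro S
      simp only [winLaw, if_neg hf, if_neg hfar]
      rw [lintegral_dirac' _ hV2]
      exact hzero _ (S.exit_mem k h hmem (not_lt.1 hfar)).1
    rw [hwin, hwin, mul_zero, zero_add, zero_add]
    exact ENNReal.ofReal_le_ofReal (by linarith [hU0 _ hmem])

end TugOfWar

theorem theorem1p1 (μ : MeasureTheory.Measure TugOfWar.Plane)
    [MeasureTheory.IsProbabilityMeasure μ] (hμ : TugOfWar.IsNoise μ)
    (hC : 0 < TugOfWar.cov μ 1 1) (η : ℝ) (hη₀ : 0 < η)
    (hη : η < Real.pi * (1 - 1 / 2 *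
      Real.sqrt (2 * (TugOfWar.exponent μ - 1) / TugOfWar.exponent μ))) :
    ∃ ε₀ : ℝ, 0 < ε₀ ∧
      ∃ S₂ : (ε : ℝ) → 0 < ε → TugOfWar.Strategy μ (TugOfWar.wedge η) ε,
        ∀ x₀ ∈ TugOfWar.wedge η,
          (⨆ (S₁ : (ε : ℝ) → 0 < ε → TugOfWar.Strategy μ (TugOfWar.wedge η) ε)
            (ε : ℝ) (hε : 0 < ε) (_ : ε < ε₀),
              ENNReal.ofReal (ε ^ 2) *
                TugOfWar.expectedEndTime μ (TugOfWar.wedge η) ε (S₁ ε hε) (S₂ ε hε) x₀) < ⊤ := by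
  have hC0 : 0 ≤ TugOfWar.cov μ 0 0 := TugOfWar.cov_self_nonneg 0
  have hratio : 2 * (TugOfWar.exponent μ - 1) / TugOfWar.exponent μ =
      2 * (1 + TugOfWar.cov μ 0 0) / (1 + TugOfWar.cov μ 0 0 + TugOfWar.cov μ 1 1) := by
    unfold TugOfWar.exponent
    have : 0 < TugOfWar.cov μ 0 0 + TugOfWar.cov μ 1 1 + 1 := by positivity
    field_simp
    ring
  rw [hratio] at hη
  have hπ : η < Real.pi := by
    refine hη.trans_le ?_
    nlinarith [Real.pi_pos, Real.sqrt_nonneg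
      (2 * (1 + TugOfWar.cov μ 0 0) / (1 + TugOfWar.cov μ 0 0 + TugOfWar.cov μ 1 1))]
  obtain ⟨M, c, U, dir, hM, hc, hUm, hdirm, hU0, hUle, hstep⟩ :=
    TugOfWar.exists_supersolution hμ hC hη₀ hπ hη
  refine ⟨1, one_pos, fun ε hε => TugOfWar.pullStrategy μ hη₀ hπ (hdirm (M * ε)) hε,
    fun x₀ hx₀ => ?_⟩
  refine lt_of_le_of_lt (b := (ENNReal.ofReal (c / 2))⁻¹ *
    ENNReal.ofReal ((x₀ 0 + M) ^ 2 / 4 + c / 2)) ?_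
    (ENNReal.mul_lt_top (by simpa using hc) ENNReal.ofReal_lt_top)
  refine iSup_le fun S₁ => iSup_le fun ε => iSup_le fun hε => iSup_le fun hε1 => ?_
  have hs : 0 < M * ε := by positivity
  have hopen := TugOfWar.isOpen_wedge hη₀ hπ
  have hdrift := TugOfWar.lyapunov_drift (c := c / 2 * ε ^ 2) hopen (by positivity)
    (hUm (M * ε)) (fun x hx => hU0 _ x hs hx) (S₁ ε hε)
    (TugOfWar.pullStrategy μ hη₀ hπ (hdirm (M * ε)) hε) (fun k h hmem hfar => by
      rw [TugOfWar.infDist_frontier_wedge hη₀ hπ hmem] at hfar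
      obtain ⟨E, hE, hsum⟩ := hstep ε hε h.pos hmem hfar
      refine ⟨E, fun w hw => ⟨(hE w hw).1, (hE w hw).2 _ (by positivity)⟩, ?_⟩
      exact (hsum _ ((S₁ ε hε).norm_move_le k h)).trans_eq (by ring))
  have hmain := TugOfWar.mul_expectedEndTime_le _ _ x₀
    (TugOfWar.measurable_lyapunov hopen.measurableSet (hUm (M * ε)) _) _ hdrift
  have hx0 : 0 < x₀ 0 := by
    obtain ⟨r, hr, θ, h1, h2, rfl⟩ := hx₀
    simpa using mul_pos hr (TugOfWar.cos_pos_of_abs_lt (abs_lt.2 ⟨by linarith, by linarith⟩))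
  have hle : TugOfWar.lyapunov (TugOfWar.wedge η) (U (M * ε)) (c / 2 * ε ^ 2) x₀ ≤
      ENNReal.ofReal ((x₀ 0 + M) ^ 2 / 4 + c / 2) := by
    have hnf : x₀ ∉ frontier (TugOfWar.wedge η) := by
      rw [hopen.frontier_eq]
      exact fun h => h.2 hx₀
    rw [TugOfWar.lyapunov, if_neg hnf, if_pos hx₀]
    refine ENNReal.ofReal_le_ofReal (add_le_add ((hUle _ x₀ hs hx₀).trans ?_) ?_)
    · have : M * ε ≤ M := mul_le_of_le_one_right hM.le hε1.le
      gcongr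
    · exact mul_le_of_le_one_right (by positivity) (pow_le_one₀ hε.le hε1.le)
  rw [ENNReal.ofReal_mul (by positivity), mul_assoc] at hmain
  rw [← ENNReal.div_eq_inv_mul,
    ENNReal.le_div_iff_mul_le (Or.inl (by simpa using hc)) (Or.inl ENNReal.ofReal_ne_top), mul_comm]
  exact hmain.trans hle
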